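/- **Setting.** Let $T\ge 1$ be such that $K=\sqrt T$ is an integer. Let $\mathcal X=\prod_{k=1}^n \mathcal X_k\subseteq\mathbb R^n_{+}$ be a product of closed intervals and let $\mathcal K\subseteq\mathcal X$ be convex with $\mathbf 0\in\mathcal K$ and $\|\mathbf x\|\le R$ for all $\mathbf x\in\mathcal K$ (Euclidean norm). $\mathcal K$ is accessed through a (measurable) linear optimization oracle returning, for any $\mathbf u$, a point of $\operatorname{argmin}_{\mathbf v\in\mathcal K}\langle \mathbf u,\mathbf v\rangle$. For rounds $t=1,\dots,T$ and nodes $i=1,\dots,N$ let $f_{t,i}:\mathcal X\to\mathbb R_+$ be fixed functions with $f_{t,i}(\mathbf 0)=0$ that are monotone (componentwise order), continuous DR-submodular (that is, $f(\mathbf x)+f(\mathbf y)\ge f(\mathbf x\vee\mathbf y)+f(\mathbf x\wedge\mathbf y)$, and $f(\mathbf x+s\mathbf e_k)-f(\mathbf x)\ge f(\mathbf y+s\mathbf e_k)-f(\mathbf y)$ whenever $\mathbf x\le\mathbf y$, $s\ge 0$ and all four points lie in $\mathcal X$), and differentiable on $\mathcal K$ with $L$-Lipschitz gradient there. Let $G>0$,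 and let every stochastic gradient $\tilde\nabla f_{t,i}(\mathbf x)$, $\mathbf x\in\mathcal K$, satisfy $\|\tilde\nabla f_{t,i}(\mathbf x)\|\le G$ and be unbiased: at the (random) query point of round $t$, its conditional mean given everything before round $t$ and the scaling sampled by node $i$ in round $t$ is $\nabla f_{t,i}$ at that point. Let $\mathcal G$ be an undirected graph on $\{1,\dots,N\}$, $\mathcal N_i$ the set consisting of $i$ and its neighbours, and $A=[a_{ij}]$ a nonnegative, symmetric, doubly stochastic matrix with $a_{ij}>0$ only if $j\in\mathcal N_i$, and $\beta=\max(|\lambda_2(A)|,|\lambda_N(A)|)<1$, where $\lambda_1\ge\dots\ge\lambda_N$ are its eigenvalues with multiplicity ($\beta=0$ if $N=1$). **Infeasible projection** $\mathcal O_{IP}(\mathcal K,\mathbf x_0,\mathbf y_0,\epsilon)$. Put $\mathbf y_1=\mathbf y_0/\max\{1,\|\mathbf y_0\|/R\}$. If $\|\mathbf x_0-\mathbf y_0\|^2\le 3\epsilon$, return $(\mathbf x_0,\mathbf y_1)$. Otherwise, with $\gamma=2\epsilon/\|\mathbf x_0-\mathbf y_0\|^2$, for $i=1,2,\dots$ compute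 $\mathbf x_i=\mathrm{SHFW}(\mathbf x_{i-1},\mathbf y_i)$, return $(\mathbf x_i,\mathbf y_i)$ if $\|\mathbf x_i-\mathbf y_i\|^2\le3\epsilon$, and else put $\mathbf y_{i+1}=\mathbf y_i-\gamma(\mathbf y_i-\mathbf x_i)$. Here $\mathrm{SHFW}(\mathbf x,\mathbf y)$ repeats: compute $\mathbf v\in\operatorname{argmin}_{\mathbf v\in\mathcal K}\langle\mathbf x-\mathbf y,\mathbf v\rangle$ (one linear optimization step); if $\langle \mathbf x-\mathbf y,\mathbf x-\mathbf v\rangle\le\epsilon$ or $\|\mathbf x-\mathbf y\|^2\le3\epsilon$, return $\mathbf x$; else replace $\mathbf x$ by the point of the segment $[\mathbf x,\mathbf v]$ closest to $\mathbf y$. **Algorithm DPOBGA.** Each node $i$ starts with $\mathbf x_1^i=\tilde{\mathbf y}_1^i=\mathbf 0$. In block $m=1,\dots,T/K$ (rounds $(m-1)K+1,\dots,mK$) it exchanges $\mathbf x_m^i,\tilde{\mathbf y}_m^i$ with its neighbours; in every round $t$ of the block it plays $\mathbf x_t^i=\mathbf x_m^i$, samples $z_t^i\in[0,1]$, independently of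 everything before round $t$, from the density $e^{u-1}/(1-e^{-1})$ on $[0,1]$, queries $\tilde\nabla f_{t,i}(z_t^i\mathbf x_m^i)$ and sets $\tilde\nabla F_{t,i}=(1-1/e)\tilde\nabla f_{t,i}(z_t^i\mathbf x_m^i)$; at the end of the block it computes $$(\mathbf x_{m+1}^i,\tilde{\mathbf y}_{m+1}^i)=\mathcal O_{IP}\Big(\mathcal K,\ \sum_{j\in\mathcal N_i}a_{ij}\mathbf x_m^j,\ \sum_{j\in\mathcal N_i}a_{ij}\tilde{\mathbf y}_m^j+\eta\sum_{t=(m-1)K+1}^{mK}\tilde\nabla F_{t,i},\ \epsilon\Big).$$ **Theorem.** Let $\eta=\frac{20R}{(1-1/e)G}T^{-3/4}$, $\epsilon=405R^2T^{-1/2}$ and $K=\sqrt T$. Then for every node $i$ all decisions of DPOBGA lie in $\mathcal K$, and the regret $$\mathcal R^i=(1-1/e)\sup_{\mathbf x\in\mathcal K}\frac1N\sum_{t=1}^T\sum_{j=1}^Nf_{t,j}(\mathbf x)-\frac1N\sum_{t=1}^T\sum_{j=1}^Nf_{t,j}(\mathbf x_t^i)$$ is integrable and satisfies $$\mathbb E[\mathcal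 R^i]\le\Big[958+86(\sqrt N+1)+\tfrac{1}{1-\beta}\big(842+130(\sqrt N+1)\big)\Big](1-e^{-1})RG\,T^{3/4}+\Big(171+\tfrac{260}{1-\beta}\Big)e^{-1}(\sqrt N+1)R^2L\,T^{3/4}.$$ Moreover each node uses at most $T$ linear optimization steps in total (in particular all loops terminate), and it exchanges information with its neighbours once per block, hence $\sqrt T$ times in total. -/

import Mathlib

open MeasureTheory ProbabilityTheory
open scoped RealInnerProductSpace

/-! ### Vectors, order, smoothness and DR-submodularity -/

/-- `ℝⁿ` with the Euclidean norm. -/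
abbrev Vec (n : ℕ) := EuclideanSpace ℝ (Fin n)

/-- Componentwise order on `ℝⁿ`. -/
def VecLE {n : ℕ} (x y : Vec n) : Prop := ∀ k, x k ≤ y k

/-- Componentwise maximum. -/
def vecMax {n : ℕ} (x y : Vec n) : Vec n := WithLp.toLp 2 fun k => max (x k) (y k)

/-- Componentwise minimum. -/
def vecMin {n : ℕ} (x y : Vec n) : Vec n := WithLp.toLp 2 fun k => min (x k) (y k)

/-- The product set `∏ₖ I k`. -/
def boxSet {n : ℕ} (I : Fin n → Set ℝ) : Set (Vec n) := {x | ∀ k, x k ∈ I k}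

/-- A closed interval of `ℝ₊` (bounded or not). -/
structure IsClosedIntervalNonneg (J : Set ℝ) : Prop where
  closed : IsClosed J
  interval : J.OrdConnected
  nonneg : ∀ u ∈ J, 0 ≤ u

/-- `f` is monotone on `X` for the componentwise order. -/
def IsMonotoneOn {n : ℕ} (f : Vec n → ℝ) (X : Set (Vec n)) : Prop :=
  ∀ x ∈ X, ∀ y ∈ X, VecLE x y → f x ≤ f y

/-- `f : X → ℝ₊` is continuous submodular. -/
structure IsContSubmodularOn {n : ℕ} (f : Vec n → ℝ) (X : Set (Vec n)) : Prop where
  nonneg : ∀ x ∈ X, 0 ≤ f x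
  submodular : ∀ x ∈ X, ∀ y ∈ X, f (vecMax x y) + f (vecMin x y) ≤ f x + f y

/-- `f : X → ℝ₊` is continuous DR-submodular. -/
structure IsDRSubmodularOn {n : ℕ} (f : Vec n → ℝ) (X : Set (Vec n)) : Prop
    extends IsContSubmodularOn f X where
  diminishing : ∀ x ∈ X, ∀ y ∈ X, VecLE x y → ∀ (i : Fin n) (s : ℝ), 0 ≤ s →
    x + EuclideanSpace.single i s ∈ X → y + EuclideanSpace.single i s ∈ X →
    f (y + EuclideanSpace.single i s) - f y ≤ f (x + EuclideanSpace.single i s) - f x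

/-- On `S ⊆ X`, the function `f : X → ℝ` is differentiable with gradient `∇f = gradf`, and `∇f` is
`L`-Lipschitz on `S`. At boundary points of `X` the derivative is taken within `X`. -/
structure IsLSmoothOn {n : ℕ} (L : ℝ) (f : Vec n → ℝ) (gradf : Vec n → Vec n)
    (S X : Set (Vec n)) : Prop where
  hasGradient : ∀ x ∈ S, HasGradientWithinAt f (gradf x) X x
  lipschitz : ∀ x ∈ S, ∀ y ∈ S, ‖gradf x - gradf y‖ ≤ L * ‖x - y‖

/-! ### Loops, the separating-hyperplane Frank–Wolfe procedure, infeasible projection -/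

open Classical in
/-- Number of executions of `step`, starting from `s`, before the stopping test `P` first succeeds
(`⊤` if it never does). -/
noncomputable def loopCount {α : Type*} (P : α → Prop) (step : α → α) (s : α) : ℕ∞ :=
  if h : ∃ k, P (step^[k] s) then ((Nat.find h : ℕ) : ℕ∞) else ⊤

/-- State in which the loop "until `P` do `step`" stops (the initial state if it never stops; this
case is recorded by `loopCount = ⊤`). -/
noncomputable def loopResult {α : Type*} (P : α → Prop) (step : α → α) (s : α) : α :=
  step^[(loopCount P step s).toNat] s

/-- `lo` is a linear optimization oracle over `𝒦`: `lo u ∈ argmin_{v ∈ 𝒦} ⟪u, v⟫`. -/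
def IsLinOpt {n : ℕ} (𝒦 : Set (Vec n)) (lo : Vec n → Vec n) : Prop :=
  ∀ u, lo u ∈ 𝒦 ∧ ∀ v ∈ 𝒦, ⟪u, lo u⟫ ≤ ⟪u, v⟫

/-- The exact line search step `argmin_{σ ∈ [0,1]} ‖y - x - σ (v - x)‖²`, in closed form. -/
noncomputable def lineSearch {n : ℕ} (y x v : Vec n) : ℝ :=
  max 0 (min 1 (⟪y - x, v - x⟫ / ‖v - x‖ ^ 2))

/-- `lineSearch` is indeed a minimizer. -/
theorem lineSearch_spec {n : ℕ} (y x v : Vec n) :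
    lineSearch y x v ∈ Set.Icc (0 : ℝ) 1 ∧ ∀ σ ∈ Set.Icc (0 : ℝ) 1,
      ‖y - x - lineSearch y x v • (v - x)‖ ^ 2 ≤ ‖y - x - σ • (v - x)‖ ^ 2 := by
  refine ⟨⟨le_max_left _ _, max_le zero_le_one (min_le_left _ _)⟩, ?_⟩
  rintro σ ⟨h0, h1⟩
  have key : ∀ s : ℝ, ‖y - x - s • (v - x)‖ ^ 2
      = ‖y - x‖ ^ 2 - 2 * s * ⟪y - x, v - x⟫ + s ^ 2 * ‖v - x‖ ^ 2 := by
    intro s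
    rw [norm_sub_sq_real, inner_smul_right, norm_smul, mul_pow, Real.norm_eq_abs, sq_abs]
    ring
  rw [key, key]
  unfold lineSearch
  rcases (sq_nonneg ‖v - x‖).eq_or_lt with hb | hb
  · have hv : v - x = 0 := by simpa using hb.symm
    simp [hv]
  · generalize hA : ⟪y - x, v - x⟫ = a
    generalize ‖v - x‖ ^ 2 = b at hb ⊢
    have hab : a = (a / b) * b := by field_simp
    generalize a / b = q at hab ⊢
    subst hab
    rcases le_total q 0 with hq | hq
    · rw [min_eq_right (by linarith), max_eq_left hq]
      nlinarith [mul_nonneg h0 hb.le, mul_nonneg (mul_nonneg h0 hb.le) (neg_nonneg.2 hq),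
        mul_nonneg (sq_nonneg σ) hb.le]
    · rcases le_total q 1 with hq1 | hq1
      · rw [min_eq_right hq1, max_eq_right hq]
        nlinarith [mul_nonneg (sq_nonneg (σ - q)) hb.le]
      · rw [min_eq_left hq1, max_eq_right zero_le_one]
        nlinarith [mul_nonneg (mul_nonneg (sub_nonneg.2 h1) (sub_nonneg.2 hq1)) hb.le,
          mul_nonneg (sq_nonneg (1 - σ)) hb.le]

/-- Stopping test of SHFW at the current point `x`. -/
def shfwStop {n : ℕ} (lo : Vec n → Vec n) (y : Vec n) (ε : ℝ) (x : Vec n) : Prop :=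
  ⟪x - y, x - lo (x - y)⟫ ≤ ε ∨ ‖x - y‖ ^ 2 ≤ 3 * ε

/-- One Frank–Wolfe step, with exact line search, for `‖x - y‖²`. -/
noncomputable def shfwStep {n : ℕ} (lo : Vec n → Vec n) (y : Vec n) (x : Vec n) : Vec n :=
  x + lineSearch y x (lo (x - y)) • (lo (x - y) - x)

/-- The point returned by SHFW started at `x₁` with target `y`. -/
noncomputable def shfw {n : ℕ} (lo : Vec n → Vec n) (x₁ y : Vec n) (ε : ℝ) : Vec n :=
  loopResult (shfwStop lo y ε) (shfwStep lo y) x₁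

/-- Number of linear optimization steps of SHFW: one in every iteration, including the last one,
in which only the stopping test is evaluated. -/
noncomputable def shfwCost {n : ℕ} (lo : Vec n → Vec n) (x₁ y : Vec n) (ε : ℝ) : ℕ∞ :=
  loopCount (shfwStop lo y ε) (shfwStep lo y) x₁ + 1

/-- A pair `(x, ỹ)` and the number of linear optimization steps spent on it. -/
structure IPState (n : ℕ) where
  x : Vec n
  yt : Vec n
  cost : ℕ∞

/-- Stopping test of the main loop of the infeasible projection. -/
def ipStop {n : ℕ} (ε : ℝ) (s : IPState n) : Prop := ‖s.x - s.yt‖ ^ 2 ≤ 3 * ε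

/-- Move `y` towards `x` and call SHFW again. -/
noncomputable def ipStep {n : ℕ} (lo : Vec n → Vec n) (ε γ : ℝ) (s : IPState n) : IPState n :=
  let y' := s.yt - γ • (s.yt - s.x)
  ⟨shfw lo s.x y' ε, y', s.cost + shfwCost lo s.x y' ε⟩

open Classical in
/-- The infeasible projection oracle `𝒪_IP(𝒦, x₀, y₀, ε)`, for `𝒦` in the ball of radius `R` and
accessed only through `lo`. A loop that never ends costs `⊤`. -/
noncomputable def infeasibleProj {n : ℕ} (lo : Vec n → Vec n) (R : ℝ) (x₀ y₀ : Vec n) (ε : ℝ) :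
    IPState n :=
  let y₁ : Vec n := (max 1 (‖y₀‖ / R))⁻¹ • y₀
  if ‖x₀ - y₀‖ ^ 2 ≤ 3 * ε then ⟨x₀, y₁, 0⟩
  else
    let γ : ℝ := 2 * ε / ‖x₀ - y₀‖ ^ 2
    let s₁ : IPState n := ⟨shfw lo x₀ y₁ ε, y₁, shfwCost lo x₀ y₁ ε⟩
    let s := loopResult (ipStop ε) (ipStep lo ε γ) s₁
    if loopCount (ipStop ε) (ipStep lo ε γ) s₁ = ⊤ then ⟨s.x, s.yt, ⊤⟩ else s

/-! ### The network -/

open Classical in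
/-- The neighbours of `i` together with `i` itself. -/
noncomputable def closedNbhd {N : ℕ} (Gr : SimpleGraph (Fin N)) (i : Fin N) : Finset (Fin N) :=
  Finset.univ.filter fun j => Gr.Adj i j ∨ j = i

/-- Nonnegative weight matrix supported on the graph, symmetric and doubly stochastic. -/
structure IsGossipMatrix {N : ℕ} (Gr : SimpleGraph (Fin N)) (A : Matrix (Fin N) (Fin N) ℝ) :
    Prop where
  nonneg : ∀ i j, 0 ≤ A i j
  supported : ∀ i j, 0 < A i j → Gr.Adj i j ∨ i = j
  symm : A.IsSymm
  stochastic : A.mulVec (fun _ => 1) = fun _ => 1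

theorem IsGossipMatrix.isHermitian {N : ℕ} {Gr : SimpleGraph (Fin N)}
    {A : Matrix (Fin N) (Fin N) ℝ} (h : IsGossipMatrix Gr A) : A.IsHermitian := by
  have := h.symm
  unfold Matrix.IsHermitian
  rw [Matrix.conjTranspose_eq_transpose_of_trivial]
  exact this

/-- `max (|λ₂|) (|λ_N|)`, where `λ₁ ≥ ⋯ ≥ λ_N` are the eigenvalues of `A` with multiplicity
(`eigenvalues₀` lists them in this order). With a single node there is no second eigenvalue and the
value is `0`. -/
noncomputable def secondEigMagnitude {N : ℕ} {A : Matrix (Fin N) (Fin N) ℝ}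
    (hA : A.IsHermitian) : ℝ :=
  if h : 2 ≤ N then
    max |hA.eigenvalues₀ ⟨1, by rw [Fintype.card_fin]; omega⟩|
      |hA.eigenvalues₀ ⟨N - 1, by rw [Fintype.card_fin]; omega⟩|
  else 0

/-! ### The algorithm -/

/-- The law of `Z`: density `e^{u-1} / (1 - e^{-1})` on `[0,1]`. -/
noncomputable def boostLaw : Measure ℝ :=
  (volume.restrict (Set.Icc 0 1)).withDensity
    fun u => ENNReal.ofReal (Real.exp (u - 1) / (1 - Real.exp (-1)))

/-- Local state of a node: decision `x`, infeasible point `ỹ`, number of linear optimization steps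
used so far, number of exchanges with the neighbours so far. -/
structure NodeState (n : ℕ) where
  x : Vec n
  yt : Vec n
  loSteps : ℕ∞
  comms : ℕ

/-- DPOBGA. `dpobga … m i` is the state of node `i` after `m` blocks, so its field `x` is the
decision played in the whole of block `m` (rounds `mK, …, (m+1)K - 1`, everything counted from
`0`). In round `t`, node `i` queries the stochastic gradient oracle `sg t i` (with noise `ξ t i`)
of its own function, at `z t i • x`. -/
noncomputable def dpobga {n N : ℕ} {Ξ : Type*} (lo : Vec n → Vec n) (R ε η : ℝ) (K : ℕ)
    (Gr : SimpleGraph (Fin N)) (A : Matrix (Fin N) (Fin N) ℝ)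
    (sg : ℕ → Fin N → Vec n → Ξ → Vec n) (z : ℕ → Fin N → ℝ) (ξ : ℕ → Fin N → Ξ) :
    ℕ → Fin N → NodeState n
  | 0 => fun _ => ⟨0, 0, 0, 0⟩
  | m + 1 => fun i =>
    let s := dpobga lo R ε η K Gr A sg z ξ m
    let gradF : ℕ → Vec n := fun t =>
      (1 - Real.exp (-1)) • sg t i (z t i • (s i).x) (ξ t i)
    let x₀ := ∑ j ∈ closedNbhd Gr i, A i j • (s j).x
    let y := ∑ j ∈ closedNbhd Gr i, A i j • (s j).yt
      + η • ∑ t ∈ Finset.Ico (m * K) ((m + 1) * K), gradF t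
    let o := infeasibleProj lo R x₀ y ε
    ⟨o.x, o.yt, (s i).loSteps + o.cost, (s i).comms + 1⟩

/-- `α`-regret over `T` rounds of the decisions `x 0, …, x (T-1)`, measured against the average of
the local functions. -/
noncomputable def avgRegret {n N : ℕ} (α : ℝ) (𝒦 : Set (Vec n)) (f : ℕ → Fin N → Vec n → ℝ)
    (T : ℕ) (x : ℕ → Vec n) : ℝ :=
  α * sSup ((fun u => 1 / (N : ℝ) * ∑ t ∈ Finset.range T, ∑ j, f t j u) '' 𝒦)
    - 1 / (N : ℝ) * ∑ t ∈ Finset.range T, ∑ j, f t j (x t)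

/-!
The regret bound combines four ingredients, and the operation count a fifth.

*Boosting* (`boost_inequality`). A monotone DR-submodular `f` satisfies
`f y - f w ≤ ⟪y, ∇f w⟫` on the box (`sub_le_inner_gradient_of_mono`). Integrating this along the ray
`s ↦ s a` against the weight `e ^ (s - 1)` shows that the averaged gradient `∇F a` satisfies
`(1 - 1/e) f u - f a ≤ ⟪u - a, ∇F a⟫`. The gradient is `L`-Lipschitz, so using another node's
decision `b` in place of `a` costs `2 R L e⁻¹ ‖a - b‖`.

*Unbiasedness* (`integral_regret_le`). The decisions of a round are determined by the past, so the
conditional expectation and the independence of the sampled scaling turn `∇F` into the stochastic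
gradients actually used, inside the expectation. This requires the whole run, in particular the
loops of the infeasible projection, to be measurable (`measurable_dpobga`).

*Regret of the linearized problem* (`GossipAscent.sum_inner_le`). The infeasible projection brings
`ỹ` closer to every point of `𝒦`, and averaging with `A` does not increase `∑ i, ‖ỹ i - u‖ ^ 2`, so
this sum is a potential for online gradient ascent at the points `A ỹ`. The actual decision is
within `√(3ε)` of `ỹ`, up to the disagreement between nodes.

*Disagreement* (`GossipAscent.norm_stack_nodeDev_le`). On vectors of zero sum `A` contracts by `β`
(`IsGossipMatrix.norm_stack_mix_le`), and in each block a node is perturbed by its gradient step and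
by the projection, which moves it by at most twice the distance of its target from the feasible
point `A x`.

*Operation count* (`infeasibleProj_spec`). A Frank–Wolfe call stops within `16 R² / ε + 1` steps,
since the excess over its last iterate obeys `u' ≤ u - (max u e) ^ 2`. Every step of the outer loop
decreases `‖ỹ - x₀‖ ^ 2` by at least `4 ε² / ‖x₀ - y₀‖ ^ 2`, and the parameters give
`‖x₀ - y₀‖ ^ 2 ≤ 8 ε`; hence at most `17` calls, and at most `K` steps in every block once
`K > 303`. For smaller `K` the tolerance covers the whole ball and one call without any Frank–Wolfe
step is enough.
-/

/-! ### Loops -/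

theorem iterate_invariant {α : Type*} {P : α → Prop} {step : α → α} {s : α} (Inv : ℕ → α → Prop)
    (h0 : Inv 0 s) (hs : ∀ k a, Inv k a → ¬ P a → Inv (k + 1) (step a)) {n : ℕ}
    (hn : ∀ k < n, ¬ P (step^[k] s)) : ∀ k ≤ n, Inv k (step^[k] s) := by
  intro k
  induction k with
  | zero => intro _; simpa using h0
  | succ k ih =>
    intro hk
    rw [Function.iterate_succ_apply']
    exact hs _ _ (ih (by omega)) (hn k (by omega))

/-- A loop that stops within `b` steps stops at the first index `k` where the test succeeds, and
its result satisfies the test and every loop invariant, indexed by the number of steps. -/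
theorem loop_spec {α : Type*} {P : α → Prop} {step : α → α} {s : α} (Inv : ℕ → α → Prop)
    (h0 : Inv 0 s) (hs : ∀ k a, Inv k a → ¬ P a → Inv (k + 1) (step a)) {b : ℕ}
    (hb : ∃ k ≤ b, P (step^[k] s)) :
    ∃ k ≤ b, loopCount P step s = k ∧ P (loopResult P step s) ∧ Inv k (loopResult P step s) := by
  classical
  obtain ⟨k₀, hk₀, hP⟩ := hb
  have hex : ∃ k, P (step^[k] s) := ⟨k₀, hP⟩
  have hcount : loopCount P step s = ((Nat.find hex : ℕ) : ℕ∞) := by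
    unfold loopCount
    rw [dif_pos hex]
  have hres : loopResult P step s = step^[Nat.find hex] s := by
    unfold loopResult
    rw [hcount, ENat.toNat_natCast]
  refine ⟨Nat.find hex, (Nat.find_min' hex hP).trans hk₀, hcount, ?_, ?_⟩
  · rw [hres]; exact Nat.find_spec hex
  · rw [hres]
    exact iterate_invariant Inv h0 hs (fun k hk => Nat.find_min hex hk) _ le_rfl

/-! ### The separating-hyperplane Frank–Wolfe procedure -/

/-- A quadratic recursion with a floor `e` on the decrement: `u` reaches `e` after about `1 / e`
steps because `u k ≤ 1 / (k + 2)`, and then drops by `e ^ 2` in every step. -/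
theorem length_le_of_quadratic_decrease {u : ℕ → ℝ} {e : ℝ} {n : ℕ} (he : 0 < e)
    (h0 : u 0 ≤ 1 / 2) (hn : 0 ≤ u n)
    (hs : ∀ k < n, u (k + 1) ≤ u k - (max (u k) e) ^ 2) : (n : ℝ) ≤ 2 / e + 1 := by
  have hanti : ∀ k j, k + j ≤ n → u (k + j) ≤ u k - j * e ^ 2 := by
    intro k j
    induction j with
    | zero => intro _; simp
    | succ j ih =>
      intro hj
      have h1 := hs (k + j) (by omega)
      have h2 := ih (by omega)
      have h3 : e ^ 2 ≤ (max (u (k + j)) e) ^ 2 := by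
        gcongr
        exact le_max_right _ _
      rw [← add_assoc]
      push_cast
      linarith
  have hpos : ∀ k ≤ n, 0 ≤ u k := by
    intro k hk
    have h1 := hanti k (n - k) (by omega)
    rw [Nat.add_sub_cancel' hk] at h1
    have : (0 : ℝ) ≤ ((n - k : ℕ) : ℝ) * e ^ 2 := by positivity
    linarith
  have hrate : ∀ k ≤ n, u k ≤ 1 / (k + 2) := by
    intro k
    induction k with
    | zero => intro _; simpa using h0
    | succ k ih =>
      intro hk
      have h1 := hs k (by omega)
      have h2 := ih (by omega)
      have h3 := hpos k (by omega)
      have h4 : u k ^ 2 ≤ (max (u k) e) ^ 2 := by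
        gcongr
        exact le_max_left _ _
      have hc : (1 : ℝ) / (k + 2) ≤ 1 / 2 := by
        apply one_div_le_one_div_of_le <;> linarith [(Nat.cast_nonneg k : (0 : ℝ) ≤ k)]
      have h5 : u k - u k ^ 2 ≤ 1 / (k + 2) - (1 / ((k : ℝ) + 2)) ^ 2 := by
        nlinarith [mul_nonneg (sub_nonneg.2 h2) (by linarith : 0 ≤ 1 - 1 / ((k : ℝ) + 2) - u k)]
      have h6 : 1 / ((k : ℝ) + 2) - (1 / ((k : ℝ) + 2)) ^ 2 ≤ 1 / ((k + 1 : ℕ) + 2) := by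
        push_cast
        rw [div_pow, div_sub_div _ _ (by positivity) (by positivity),
          div_le_div_iff₀ (by positivity) (by positivity)]
        nlinarith [(Nat.cast_nonneg k : (0 : ℝ) ≤ k)]
      linarith
  set p := ⌈1 / e⌉₊ with hp
  have hp1 : 1 / e ≤ p := Nat.le_ceil _
  have hp2 : (p : ℝ) < 1 / e + 1 := Nat.ceil_lt_add_one (by positivity)
  have h2e : 2 / e = 1 / e + 1 / e := by ring
  have hepos : 0 < 1 / e := by positivity
  rcases le_total n p with hnp | hnp
  · have : (n : ℝ) ≤ p := by exact_mod_cast hnp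
    linarith
  · have h1 := hanti p (n - p) (by omega)
    rw [Nat.add_sub_cancel' hnp] at h1
    have h2 := hrate p hnp
    have h3 : (1 : ℝ) / (p + 2) ≤ e := by
      rw [div_le_iff₀ (by positivity)]
      rw [div_le_iff₀ he] at hp1
      nlinarith
    have h4 : ((n - p : ℕ) : ℝ) * e ^ 2 ≤ e := by linarith
    have h5 : ((n - p : ℕ) : ℝ) ≤ 1 / e := by
      rw [le_div_iff₀ he]
      by_contra hcon
      push Not at hcon
      nlinarith
    rw [Nat.cast_sub hnp] at h5
    linarith

section
variable {n : ℕ} {𝒦 : Set (Vec n)} {R ε : ℝ} {lo : Vec n → Vec n}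

theorem shfwStep_mem (h𝒦 : Convex ℝ 𝒦) (hlo : IsLinOpt 𝒦 lo) (y : Vec n) {x : Vec n}
    (hx : x ∈ 𝒦) : shfwStep lo y x ∈ 𝒦 := by
  unfold shfwStep
  exact h𝒦.add_smul_sub_mem hx (hlo _).1 (lineSearch_spec _ _ _).1

theorem norm_sub_sq_le_four {x y : Vec n} (hx : ‖x‖ ≤ R) (hy : ‖y‖ ≤ R) :
    ‖x - y‖ ^ 2 ≤ 4 * R ^ 2 := by
  have h := norm_sub_le x y
  have h0 := norm_nonneg (x - y)
  nlinarith

/-- Progress of a line search step as long as the Frank–Wolfe gap exceeds `ε`. -/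
theorem shfwStep_decrease (hR : ∀ x ∈ 𝒦, ‖x‖ ≤ R) (hlo : IsLinOpt 𝒦 lo) (hε : 0 < ε)
    {x y : Vec n} (hx : x ∈ 𝒦) (hy : ‖y‖ ≤ R) (hgap : ε < ⟪x - y, x - lo (x - y)⟫) :
    ‖shfwStep lo y x - y‖ ^ 2
      ≤ ‖x - y‖ ^ 2 - ⟪x - y, x - lo (x - y)⟫ ^ 2 / (4 * R ^ 2) := by
  set v := lo (x - y) with hv
  set g := ⟪x - y, x - v⟫ with hg
  have hvx : ‖v - x‖ ^ 2 ≤ 4 * R ^ 2 := norm_sub_sq_le_four (hR _ (hlo _).1) (hR _ hx)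
  have hxy : ‖x - y‖ ^ 2 ≤ 4 * R ^ 2 := norm_sub_sq_le_four (hR _ hx) hy
  have hg_le : g ≤ 4 * R ^ 2 := by
    have h1 : g ≤ ‖x - y‖ * ‖x - v‖ := real_inner_le_norm _ _
    rw [norm_sub_rev x v] at h1
    nlinarith [sq_nonneg (‖x - y‖ - ‖v - x‖)]
  have hRpos : 0 < 4 * R ^ 2 := by linarith
  have hs := (lineSearch_spec y x v).2 (g / (4 * R ^ 2))
    ⟨div_nonneg (hε.le.trans hgap.le) hRpos.le, by rw [div_le_one hRpos]; exact hg_le⟩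
  have e1 : ‖shfwStep lo y x - y‖ = ‖y - x - lineSearch y x v • (v - x)‖ := by
    rw [← norm_neg]
    congr 1
    unfold shfwStep
    rw [← hv]
    abel
  rw [e1]
  refine hs.trans ?_
  rw [norm_sub_sq_real, inner_smul_right, norm_smul, mul_pow, Real.norm_eq_abs, sq_abs,
    norm_sub_rev y x]
  have e2 : ⟪y - x, v - x⟫ = g := by
    rw [hg, ← inner_neg_neg, neg_sub, neg_sub]
  rw [e2]
  have h3 : (g / (4 * R ^ 2)) ^ 2 * ‖v - x‖ ^ 2 ≤ (g / (4 * R ^ 2)) ^ 2 * (4 * R ^ 2) := by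
    gcongr
  have h4 : (g / (4 * R ^ 2)) ^ 2 * (4 * R ^ 2) = g ^ 2 / (4 * R ^ 2) := by
    field_simp
  have h5 : 2 * (g / (4 * R ^ 2) * g) = 2 * (g ^ 2 / (4 * R ^ 2)) := by ring
  linarith

/-- The Frank–Wolfe gap at `x` dominates half the excess of `‖x - y‖ ^ 2` over any feasible
value. -/
theorem half_sub_le_gap (hlo : IsLinOpt 𝒦 lo) (x y : Vec n) {w : Vec n} (hw : w ∈ 𝒦) :
    (‖x - y‖ ^ 2 - ‖w - y‖ ^ 2) / 2 ≤ ⟪x - y, x - lo (x - y)⟫ := by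
  have h1 := (hlo (x - y)).2 w hw
  have h2 : ‖w - y‖ ^ 2 = ‖x - y‖ ^ 2 - 2 * ⟪x - y, x - w⟫ + ‖x - w‖ ^ 2 := by
    rw [← norm_sub_sq_real]
    congr 2
    abel
  rw [inner_sub_right] at h2 ⊢
  nlinarith [sq_nonneg ‖x - w‖]

theorem shfw_stops (h𝒦 : Convex ℝ 𝒦) (hR : ∀ x ∈ 𝒦, ‖x‖ ≤ R) (hlo : IsLinOpt 𝒦 lo)
    (hε : 0 < ε) {x y : Vec n} (hx : x ∈ 𝒦) (hy : ‖y‖ ≤ R) :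
    ∃ k ≤ ⌊16 * R ^ 2 / ε + 1⌋₊, shfwStop lo y ε ((shfwStep lo y)^[k] x) := by
  by_contra! hcon
  set n := ⌊16 * R ^ 2 / ε + 1⌋₊ + 1 with hn
  have hno : ∀ k < n, ¬ shfwStop lo y ε ((shfwStep lo y)^[k] x) := fun k hk => hcon k (by omega)
  have hmem : ∀ k, (shfwStep lo y)^[k] x ∈ 𝒦 := by
    intro k
    induction k with
    | zero => exact hx
    | succ k ih => rw [Function.iterate_succ_apply']; exact shfwStep_mem h𝒦 hlo y ih
  have hRpos : 0 < R ^ 2 := by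
    have h1 := hno 0 (by omega)
    simp only [shfwStop, not_or, not_le, Function.iterate_zero, id] at h1
    have := norm_sub_sq_le_four (hR _ hx) hy
    linarith
  -- the excess is measured against the last iterate, so that no minimizer is needed
  set H : ℕ → ℝ := fun k => ‖(shfwStep lo y)^[k] x - y‖ ^ 2 with hH
  set u : ℕ → ℝ := fun k => (H k - H n) / (16 * R ^ 2) with hu
  have key : (n : ℝ) ≤ 2 / (ε / (8 * R ^ 2)) + 1 := by
    refine length_le_of_quadratic_decrease (u := u) (by positivity) ?_ (by simp [hu]) ?_
    · have h1 : H 0 ≤ 4 * R ^ 2 := norm_sub_sq_le_four (hR _ hx) hy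
      have h2 : 0 ≤ H n := sq_nonneg _
      simp only [hu]
      rw [div_le_iff₀ (by positivity)]
      linarith
    · intro k hk
      have h1 := hno k hk
      simp only [shfwStop, not_or, not_le] at h1
      have h2 := shfwStep_decrease hR hlo hε (hmem k) hy h1.1
      have h3 := half_sub_le_gap hlo ((shfwStep lo y)^[k] x) y (hmem n)
      rw [← Function.iterate_succ_apply' (shfwStep lo y)] at h2
      set g := ⟪(shfwStep lo y)^[k] x - y,
        (shfwStep lo y)^[k] x - lo ((shfwStep lo y)^[k] x - y)⟫ with hg
      have h4 : max (u k) (ε / (8 * R ^ 2)) ≤ g / (8 * R ^ 2) := by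
        refine max_le ?_ (by gcongr; exact h1.1.le)
        simp only [hu]
        rw [div_le_div_iff₀ (by positivity) (by positivity)]
        have : H k - H n ≤ 2 * g := by simp only [hH]; linarith
        nlinarith
      have h5 : 0 ≤ max (u k) (ε / (8 * R ^ 2)) := le_max_of_le_right (by positivity)
      have h6 : max (u k) (ε / (8 * R ^ 2)) ^ 2 ≤ (g / (8 * R ^ 2)) ^ 2 := by gcongr
      have h7 : u (k + 1) ≤ u k - (g ^ 2 / (4 * R ^ 2)) / (16 * R ^ 2) := by
        have : H (k + 1) ≤ H k - g ^ 2 / (4 * R ^ 2) := h2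
        simp only [hu, ← sub_div]
        exact div_le_div_of_nonneg_right (by linarith) (by positivity)
      have h8 : (g ^ 2 / (4 * R ^ 2)) / (16 * R ^ 2) = (g / (8 * R ^ 2)) ^ 2 := by
        field_simp; ring
      linarith
  have h1 : 16 * R ^ 2 / ε + 1 < n := by
    rw [hn]; push_cast; exact Nat.lt_floor_add_one _
  have h2 : 2 / (ε / (8 * R ^ 2)) = 16 * R ^ 2 / ε := by field_simp; ring
  linarith

theorem shfw_spec (h𝒦 : Convex ℝ 𝒦) (hR : ∀ x ∈ 𝒦, ‖x‖ ≤ R) (hlo : IsLinOpt 𝒦 lo)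
    (hε : 0 < ε) {x y : Vec n} (hx : x ∈ 𝒦) (hy : ‖y‖ ≤ R) :
    shfw lo x y ε ∈ 𝒦 ∧ shfwStop lo y ε (shfw lo x y ε) ∧
      shfwCost lo x y ε ≤ ((⌊16 * R ^ 2 / ε + 1⌋₊ + 1 : ℕ) : ℕ∞) := by
  obtain ⟨k, hk, hc, hP, hI⟩ := loop_spec (fun _ a => a ∈ 𝒦) hx
    (fun _ a ha _ => shfwStep_mem h𝒦 hlo y ha) (shfw_stops h𝒦 hR hlo hε hx hy)
  refine ⟨hI, hP, ?_⟩
  unfold shfwCost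
  rw [hc]
  exact_mod_cast Nat.succ_le_succ hk

/-- No Frank–Wolfe step is made if the starting point is already close enough. -/
theorem shfw_of_close {x y : Vec n} (h : ‖x - y‖ ^ 2 ≤ 3 * ε) :
    shfw lo x y ε = x ∧ shfwCost lo x y ε = 1 := by
  obtain ⟨k, hk, hc, -, hI⟩ := loop_spec (P := shfwStop lo y ε) (step := shfwStep lo y) (s := x)
    (fun k a => k = 0 → a = x) (fun _ => rfl) (fun k a _ _ h => absurd h (by omega))
    (b := 0) ⟨0, le_rfl, Or.inr h⟩
  obtain rfl : k = 0 := by omega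
  exact ⟨hI rfl, by simp [shfwCost, hc]⟩

/-! ### The infeasible projection -/

/-- The first point of the infeasible projection lies in the ball. This fails for `R = 0`, where
`‖y‖ / R = 0` and nothing is projected. -/
theorem norm_radial_le (hR0 : 0 < R) (y : Vec n) :
    ‖(max 1 (‖y‖ / R))⁻¹ • y‖ ≤ R := by
  have h1 : 0 < max 1 (‖y‖ / R) := lt_of_lt_of_le one_pos (le_max_left _ _)
  rw [norm_smul, norm_inv, Real.norm_of_nonneg h1.le, inv_mul_le_iff₀ h1]
  calc ‖y‖ = ‖y‖ / R * R := by field_simp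
    _ ≤ max 1 (‖y‖ / R) * R := by gcongr; exact le_max_right _ _

/-- The radial projection onto the ball brings `y` closer to every point of the ball. -/
theorem norm_radial_sub_le (hR0 : 0 ≤ R) (y : Vec n) {z : Vec n} (hz : ‖z‖ ≤ R) :
    ‖(max 1 (‖y‖ / R))⁻¹ • y - z‖ ≤ ‖y - z‖ := by
  rcases le_total (‖y‖ / R) 1 with h | h
  · rw [max_eq_left h]; simp
  rw [max_eq_right h]
  set q := ‖y‖ / R with hq
  have hR1 : 0 < R := by
    rcases hR0.eq_or_lt with h0 | h0
    · rw [← h0, div_zero] at hq; linarith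
    · exact h0
  have hy : ‖y‖ = q * R := by rw [hq]; field_simp
  have hq0 : 0 < q := by linarith
  have hc0 : 0 < q⁻¹ := by positivity
  have hc1 : q⁻¹ ≤ 1 := inv_le_one_of_one_le₀ h
  have hcq : q⁻¹ * q = 1 := inv_mul_cancel₀ hq0.ne'
  refine le_of_sq_le_sq ?_ (norm_nonneg _)
  rw [norm_sub_sq_real, norm_sub_sq_real, inner_smul_left, norm_smul, mul_pow, norm_inv,
    Real.norm_of_nonneg hq0.le, hy]
  simp only [conj_trivial]
  have hin : ⟪y, z⟫ ≤ q * R * R := by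
    calc ⟪y, z⟫ ≤ ‖y‖ * ‖z‖ := real_inner_le_norm _ _
      _ ≤ q * R * R := by rw [hy]; gcongr
  have e : (q⁻¹) ^ 2 * (q * R) ^ 2 = R ^ 2 := by
    calc (q⁻¹) ^ 2 * (q * R) ^ 2 = (q⁻¹ * q) ^ 2 * R ^ 2 := by ring
      _ = R ^ 2 := by rw [hcq]; ring
  rw [e]
  have h1 : (1 - q⁻¹) * ⟪y, z⟫ ≤ (1 - q⁻¹) * (q * R * R) := by
    apply mul_le_mul_of_nonneg_left hin; linarith
  have h2 : (1 - q⁻¹) * (q * R * R) = (q - 1) * R ^ 2 := by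
    calc (1 - q⁻¹) * (q * R * R) = (q - q⁻¹ * q) * R ^ 2 := by ring
      _ = _ := by rw [hcq]
  nlinarith [mul_nonneg (sq_nonneg (q - 1)) (sq_nonneg R)]

/-- Moving `y` towards a point `x` whose Frank–Wolfe gap is at most `ε` brings `y` closer to every
feasible point. -/
theorem norm_ipStep_sub_sq_le (hlo : IsLinOpt 𝒦 lo) {γ : ℝ} (hγ0 : 0 ≤ γ)
    (hγ : γ ≤ 2 / 3) (hε : 0 ≤ ε) {x y z : Vec n} (hz : z ∈ 𝒦) (hhalt : shfwStop lo y ε x)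
    (hfar : 3 * ε < ‖x - y‖ ^ 2) :
    ‖y - γ • (y - x) - z‖ ^ 2 ≤ ‖y - z‖ ^ 2 - 2 * ε * γ := by
  have hgap : ⟪x - y, x - z⟫ ≤ ε := by
    have h1 : ⟪x - y, x - lo (x - y)⟫ ≤ ε := hhalt.resolve_right (not_le.2 hfar)
    have h2 := (hlo (x - y)).2 z hz
    rw [inner_sub_right] at h1 ⊢
    linarith
  have e1 : y - γ • (y - x) - z = (y - z) - γ • (y - x) := by abel
  have e2 : ⟪y - z, y - x⟫ = ‖y - x‖ ^ 2 - ⟪x - y, x - z⟫ := by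
    have : y - z = (y - x) + (x - z) := by abel
    rw [this, inner_add_left, real_inner_self_eq_norm_sq, real_inner_comm, ← neg_sub x y,
      inner_neg_left]
    simp only [norm_neg]
    ring
  rw [e1, norm_sub_sq_real, inner_smul_right, norm_smul, mul_pow, Real.norm_eq_abs, sq_abs, e2]
  rw [norm_sub_rev x y] at hfar
  have h3 : γ * (2 - γ) * (3 * ε) ≤ γ * (2 - γ) * ‖y - x‖ ^ 2 := by
    apply mul_le_mul_of_nonneg_left hfar.le
    apply mul_nonneg hγ0; linarith
  have h4 : γ * ⟪x - y, x - z⟫ ≤ γ * ε := by gcongr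
  have h5 : 0 ≤ ε * γ * (2 - 3 * γ) := by
    apply mul_nonneg (mul_nonneg hε hγ0); linarith
  nlinarith

/-- Invariant of the main loop of the infeasible projection after `k` steps, when each call of
SHFW costs at most `c`. -/
structure IPInv (𝒦 : Set (Vec n)) (lo : Vec n → Vec n) (R ε γ : ℝ) (y₀ : Vec n) (c : ℕ)
    (k : ℕ) (s : IPState n) : Prop where
  mem : s.x ∈ 𝒦
  norm_le : ‖s.yt‖ ≤ R
  halted : shfwStop lo s.yt ε s.x
  dist : ∀ z ∈ 𝒦, ‖s.yt - z‖ ^ 2 ≤ ‖y₀ - z‖ ^ 2 - k * (2 * ε * γ)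
  cost : s.cost ≤ (((k + 1) * c : ℕ) : ℕ∞)

theorem IPInv.step (h𝒦 : Convex ℝ 𝒦) (hR : ∀ x ∈ 𝒦, ‖x‖ ≤ R) (hlo : IsLinOpt 𝒦 lo)
    (hε : 0 < ε) {γ : ℝ} (hγ0 : 0 ≤ γ) (hγ : γ ≤ 2 / 3) {y₀ : Vec n} {k : ℕ} {s : IPState n}
    (h : IPInv 𝒦 lo R ε γ y₀ (⌊16 * R ^ 2 / ε + 1⌋₊ + 1) k s) (hs : ¬ ipStop ε s) :
    IPInv 𝒦 lo R ε γ y₀ (⌊16 * R ^ 2 / ε + 1⌋₊ + 1) (k + 1) (ipStep lo ε γ s) := by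
  have hfar : 3 * ε < ‖s.x - s.yt‖ ^ 2 := not_le.1 hs
  have hy : ‖s.yt - γ • (s.yt - s.x)‖ ≤ R := by
    have h1 : s.yt - γ • (s.yt - s.x) = (1 - γ) • s.yt + γ • s.x := by
      rw [smul_sub, sub_smul, one_smul]; abel
    rw [h1]
    calc _ ≤ ‖(1 - γ) • s.yt‖ + ‖γ • s.x‖ := norm_add_le _ _
      _ = (1 - γ) * ‖s.yt‖ + γ * ‖s.x‖ := by
        rw [norm_smul, norm_smul, Real.norm_of_nonneg hγ0, Real.norm_of_nonneg (by linarith)]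
      _ ≤ (1 - γ) * R + γ * R := by
        gcongr
        · linarith
        · exact h.norm_le
        · exact hR _ h.mem
      _ = R := by ring
  obtain ⟨h1, h2, h3⟩ := shfw_spec h𝒦 hR hlo hε h.mem hy
  refine ⟨h1, hy, h2, ?_, ?_⟩
  · intro z hz
    have h4 := norm_ipStep_sub_sq_le hlo hγ0 hγ hε.le hz h.halted hfar
    have h5 := h.dist z hz
    push_cast
    simp only [ipStep]
    linarith
  · simp only [ipStep]
    calc s.cost + _ ≤ (((k + 1) * (⌊16 * R ^ 2 / ε + 1⌋₊ + 1) : ℕ) : ℕ∞)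
          + ((⌊16 * R ^ 2 / ε + 1⌋₊ + 1 : ℕ) : ℕ∞) := add_le_add h.cost h3
      _ = _ := by rw [← Nat.cast_add]; congr 1; ring

/-- Outcome of the infeasible projection: a feasible point `x` near `ỹ`, where `ỹ` is at least as
close to every feasible point as the input `y₀` was. -/
structure IPGood (𝒦 : Set (Vec n)) (ε : ℝ) (y₀ : Vec n) (o : IPState n) : Prop where
  mem : o.x ∈ 𝒦
  close : ‖o.x - o.yt‖ ^ 2 ≤ 3 * ε
  dist : ∀ z ∈ 𝒦, ‖o.yt - z‖ ≤ ‖y₀ - z‖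

/-- Specification and cost of the infeasible projection. The comparison point `x₀` bounds the number
of outer steps by `(8 ε) ^ 2 / (4 ε ^ 2) = 16`. For `R = 0` the radial projection is void, and the
input is assumed to be within the tolerance. -/
theorem infeasibleProj_spec (h𝒦 : Convex ℝ 𝒦) (hR : ∀ x ∈ 𝒦, ‖x‖ ≤ R) (hlo : IsLinOpt 𝒦 lo)
    {x₀ y₀ : Vec n} (hx₀ : x₀ ∈ 𝒦) (hD : ‖x₀ - y₀‖ ^ 2 ≤ 8 * ε)
    (hR0' : R = 0 → ‖x₀ - y₀‖ ^ 2 ≤ 3 * ε) :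
    IPGood 𝒦 ε y₀ (infeasibleProj lo R x₀ y₀ ε) ∧
      (infeasibleProj lo R x₀ y₀ ε).cost
        ≤ ((17 * (⌊16 * R ^ 2 / ε + 1⌋₊ + 1) : ℕ) : ℕ∞) := by
  have hR0 : 0 ≤ R := (norm_nonneg _).trans (hR _ hx₀)
  set y₁ : Vec n := (max 1 (‖y₀‖ / R))⁻¹ • y₀ with hy₁
  have hdist : ∀ z ∈ 𝒦, ‖y₁ - z‖ ≤ ‖y₀ - z‖ := fun z hz =>
    norm_radial_sub_le hR0 y₀ (hR z hz)
  by_cases hc : ‖x₀ - y₀‖ ^ 2 ≤ 3 * ε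
  · have e : infeasibleProj lo R x₀ y₀ ε = ⟨x₀, y₁, 0⟩ := by
      unfold infeasibleProj; simp [hc, hy₁]
    rw [e]
    refine ⟨⟨hx₀, ?_, hdist⟩, by simp⟩
    have h1 := hdist x₀ hx₀
    rw [norm_sub_rev, norm_sub_rev y₀] at h1
    refine le_trans ?_ hc
    simp only
    gcongr
  · have hfar := not_le.1 hc
    have hε : 0 < ε := by linarith
    set D := ‖x₀ - y₀‖ ^ 2 with hDdef
    have hD0 : 0 < D := by linarith
    set γ : ℝ := 2 * ε / D with hγdef
    have hγ0 : 0 ≤ γ := by positivity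
    have hγ1 : γ ≤ 2 / 3 := by rw [hγdef, div_le_iff₀ hD0]; linarith
    set s₁ : IPState n := ⟨shfw lo x₀ y₁ ε, y₁, shfwCost lo x₀ y₁ ε⟩ with hs₁
    have hy₁R : ‖y₁‖ ≤ R :=
      norm_radial_le (lt_of_le_of_ne hR0 fun h => hc (hR0' h.symm)) y₀
    obtain ⟨a1, a2, a3⟩ := shfw_spec h𝒦 hR hlo hε hx₀ hy₁R
    have hinv0 : IPInv 𝒦 lo R ε γ y₀ (⌊16 * R ^ 2 / ε + 1⌋₊ + 1) 0 s₁ := by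
      refine ⟨a1, hy₁R, a2, ?_, ?_⟩
      · intro z hz
        have := hdist z hz
        simp only [hs₁, Nat.cast_zero, zero_mul, sub_zero]
        gcongr
      · simpa [hs₁] using a3
    have hstep : ∀ k a, IPInv 𝒦 lo R ε γ y₀ (⌊16 * R ^ 2 / ε + 1⌋₊ + 1) k a → ¬ ipStop ε a →
        IPInv 𝒦 lo R ε γ y₀ (⌊16 * R ^ 2 / ε + 1⌋₊ + 1) (k + 1) (ipStep lo ε γ a) :=
      fun k a h hs => h.step h𝒦 hR hlo hε hγ0 hγ1 hs
    have hex : ∃ k ≤ 16, ipStop ε ((ipStep lo ε γ)^[k] s₁) := by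
      by_contra! hcon
      have h1 := (iterate_invariant (P := ipStop ε) _ hinv0 hstep (n := 17)
        (fun k hk => hcon k (by omega)) 17 le_rfl).dist x₀ hx₀
      have h2 := sq_nonneg ‖((ipStep lo ε γ)^[17] s₁).yt - x₀‖
      rw [norm_sub_rev y₀ x₀, ← hDdef] at h1
      have h3 : ((17 : ℕ) : ℝ) * (2 * ε * γ) ≤ D := by linarith
      rw [hγdef] at h3
      have h4 : ((17 : ℕ) : ℝ) * (2 * ε * (2 * ε / D)) = 68 * ε ^ 2 / D := by
        push_cast; ring
      rw [h4, div_le_iff₀ hD0] at h3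
      nlinarith
    obtain ⟨k, hk, hcount, hP, hI⟩ := loop_spec _ hinv0 hstep hex
    have e : infeasibleProj lo R x₀ y₀ ε = loopResult (ipStop ε) (ipStep lo ε γ) s₁ := by
      have hne : loopCount (ipStop ε) (ipStep lo ε γ) s₁ ≠ ⊤ := by
        rw [hcount]; exact ENat.natCast_ne_top k
      unfold infeasibleProj
      rw [if_neg hc]
      exact if_neg hne
    rw [e]
    refine ⟨⟨hI.mem, hP, ?_⟩, ?_⟩
    · intro z hz
      refine le_of_sq_le_sq ((hI.dist z hz).trans ?_) (norm_nonneg _)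
      have : 0 ≤ (k : ℝ) * (2 * ε * γ) := by positivity
      linarith
    · refine hI.cost.trans ?_
      gcongr
      omega

/-- If the whole ball is within the tolerance, SHFW is called at most once and makes no step. -/
theorem infeasibleProj_cost_le_one (hR : ∀ x ∈ 𝒦, ‖x‖ ≤ R) {x₀ y₀ : Vec n} (hx₀ : x₀ ∈ 𝒦)
    (hR0' : R = 0 → ‖x₀ - y₀‖ ^ 2 ≤ 3 * ε) (hbig : 4 * R ^ 2 ≤ 3 * ε) :
    (infeasibleProj lo R x₀ y₀ ε).cost ≤ 1 := by
  by_cases hc : ‖x₀ - y₀‖ ^ 2 ≤ 3 * ε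
  · unfold infeasibleProj; simp [hc]
  · have hR0 : 0 < R :=
      lt_of_le_of_ne ((norm_nonneg _).trans (hR _ hx₀)) fun h => hc (hR0' h.symm)
    have h1 : ‖x₀ - (max 1 (‖y₀‖ / R))⁻¹ • y₀‖ ^ 2 ≤ 3 * ε :=
      (norm_sub_sq_le_four (hR _ hx₀) (norm_radial_le hR0 y₀)).trans hbig
    obtain ⟨e1, e2⟩ := shfw_of_close (lo := lo) h1
    obtain ⟨k, hk, hcount, -, hI⟩ := loop_spec (P := ipStop ε)
      (step := ipStep lo ε (2 * ε / ‖x₀ - y₀‖ ^ 2))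
      (s := ⟨x₀, (max 1 (‖y₀‖ / R))⁻¹ • y₀, 1⟩) (fun k a => k = 0 → a.cost = 1)
      (fun _ => rfl) (fun k a _ _ h => absurd h (by omega)) (b := 0) ⟨0, le_rfl, h1⟩
    obtain rfl : k = 0 := by omega
    unfold infeasibleProj
    simp only [if_neg hc, e1, e2]
    rw [if_neg (by rw [hcount]; exact ENat.natCast_ne_top 0)]
    exact (hI rfl).le

end

/-! ### Continuous DR-submodular functions -/

section
variable {n : ℕ} {I : Fin n → Set ℝ} {f : Vec n → ℝ}

/-- The partial sum `∑_{k < j} v_k e_k`. -/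
noncomputable def truncVec (v : Vec n) (j : ℕ) : Vec n :=
  WithLp.toLp 2 fun k => if (k : ℕ) < j then v k else 0

theorem truncVec_zero (v : Vec n) : truncVec v 0 = 0 := by
  ext k; simp [truncVec]

theorem truncVec_card (v : Vec n) : truncVec v n = v := by
  ext k; simp [truncVec]

theorem truncVec_succ (v : Vec n) (j : Fin n) :
    truncVec v (j + 1) = truncVec v j + EuclideanSpace.single j (v j) := by
  ext k
  simp only [truncVec, PiLp.add_apply, PiLp.single_apply]
  by_cases hk : k = j
  · subst hk; simp
  · have h1 : (k : ℕ) ≠ j := fun h => hk (Fin.ext h)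
    have h2 : (k : ℕ) < j + 1 ↔ (k : ℕ) < j := by omega
    simp [hk, h2]

theorem add_single_apply (w : Vec n) (k j : Fin n) (s : ℝ) :
    (w + EuclideanSpace.single k s) j = if j = k then w k + s else w j := by
  by_cases h : j = k
  · subst h; simp
  · simp [h]

/-- The box contains every point which lies coordinatewise between two of its points. -/
theorem boxSet_mem_of_between (hI : ∀ k, IsClosedIntervalNonneg (I k)) {w w' p : Vec n}
    (hw : w ∈ boxSet I) (hw' : w' ∈ boxSet I) (h1 : ∀ k, w k ≤ p k) (h2 : ∀ k, p k ≤ w' k) :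
    p ∈ boxSet I :=
  fun k => (hI k).interval.out (hw k) (hw' k) ⟨h1 k, h2 k⟩

/-- Along a positive coordinate direction, equal steps of a DR-submodular function have
non-increasing increments. -/
theorem sub_le_nsmul_of_dr (hI : ∀ k, IsClosedIntervalNonneg (I k))
    (hf : IsDRSubmodularOn f (boxSet I)) {w : Vec n} (hw : w ∈ boxSet I) (k : Fin n) {s : ℝ}
    (hs : 0 ≤ s) (m : ℕ) (hm : w + EuclideanSpace.single k (m * s) ∈ boxSet I) :
    f (w + EuclideanSpace.single k (m * s)) - f w
      ≤ m * (f (w + EuclideanSpace.single k s) - f w) := by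
  induction m with
  | zero =>
    have h0 : w + EuclideanSpace.single k (((0 : ℕ) : ℝ) * s) = w := by
      ext j; rw [add_single_apply]; split_ifs with h <;> simp [h]
    rw [h0]; simp
  | succ m ih =>
    have hsplit : w + EuclideanSpace.single k (((m + 1 : ℕ) : ℝ) * s)
        = w + EuclideanSpace.single k (m * s) + EuclideanSpace.single k s := by
      rw [add_assoc]
      congr 1
      ext j
      by_cases h : j = k
      · subst h; simp; ring
      · simp [h]
    have hms : (0 : ℝ) ≤ m * s := by positivity
    have hbet : ∀ r : ℝ, 0 ≤ r → r ≤ ((m + 1 : ℕ) : ℝ) * s →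
        w + EuclideanSpace.single k r ∈ boxSet I := by
      intro r hr0 hr1
      refine boxSet_mem_of_between hI hw hm ?_ ?_ <;> intro j <;>
        simp only [add_single_apply] <;> split_ifs with h
      · subst h; linarith
      · exact le_rfl
      · linarith
      · exact le_rfl
    have h1 := hbet (m * s) hms (by push_cast; nlinarith)
    have h2 := hbet s hs (by push_cast; nlinarith)
    have hle : VecLE w (w + EuclideanSpace.single k (m * s)) := by
      intro j
      rw [add_single_apply]
      split_ifs with h
      · subst h; linarith
      · exact le_rfl
    have h3 := hf.diminishing w hw _ h1 hle k s hs h2 (hsplit ▸ hm)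
    rw [← hsplit] at h3
    have h4 := ih h1
    push_cast at h3 ⊢
    linarith

/-- The one-sided difference quotients of `f` at `w` in direction `d` converge to `⟪g, d⟫`. -/
theorem tendsto_slope_direction {X : Set (Vec n)} {w g d : Vec n} (hg : HasGradientWithinAt f g X w)
    {r : ℕ → ℝ} (hr0 : ∀ m, 0 < r m) (hr : Filter.Tendsto r Filter.atTop (nhds 0))
    (hmem : ∀ m, w + r m • d ∈ X) :
    Filter.Tendsto (fun m => (r m)⁻¹ * (f (w + r m • d) - f w)) Filter.atTop
      (nhds ⟪g, d⟫) := by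
  have h := hg.hasFDerivWithinAt.lim (l := Filter.atTop) (c := fun m => (r m)⁻¹)
    (d := fun m => r m • d) (v := d) (by simpa using hr.smul_const d)
    (Filter.Eventually.of_forall hmem)
    (by
      refine tendsto_const_nhds.congr fun m => ?_
      rw [smul_smul, inv_mul_cancel₀ (hr0 m).ne', one_smul])
  simpa using h

theorem tendsto_one_div_succ :
    Filter.Tendsto (fun m : ℕ => 1 / ((m : ℝ) + 1)) Filter.atTop (nhds 0) :=
  tendsto_one_div_add_atTop_nhds_zero_nat

theorem boxSet_add_smul_single_mem (hI : ∀ k, IsClosedIntervalNonneg (I k)) {w : Vec n}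
    (hw : w ∈ boxSet I) {k : Fin n} {s : ℝ} (hs : w + EuclideanSpace.single k s ∈ boxSet I)
    {r : ℝ} (hr0 : 0 ≤ r) (hr1 : r ≤ 1) : w + r • EuclideanSpace.single k s ∈ boxSet I := by
  intro j
  have h1 := hw j
  have h2 := hs j
  rw [add_single_apply] at h2
  by_cases h : j = k
  · subst h
    rw [if_pos rfl] at h2
    have := (hI j).interval.convex.add_smul_mem h1 h2 ⟨hr0, hr1⟩
    simpa using this
  · simpa [h] using h1

theorem inner_single (g : Vec n) (k : Fin n) (s : ℝ) :
    ⟪g, EuclideanSpace.single k s⟫ = s * g k := by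
  rw [EuclideanSpace.inner_single_right]; simp

/-- A gradient component is nonnegative whenever the box allows a move in that coordinate. -/
theorem gradient_nonneg (hI : ∀ k, IsClosedIntervalNonneg (I k))
    (hmono : IsMonotoneOn f (boxSet I)) {w g : Vec n} (hw : w ∈ boxSet I)
    (hg : HasGradientWithinAt f g (boxSet I) w) {k : Fin n} {s : ℝ} (hs : s ≠ 0)
    (hmem : w + EuclideanSpace.single k s ∈ boxSet I) : 0 ≤ g k := by
  have hr : ∀ m : ℕ, 0 < 1 / ((m : ℝ) + 1) := fun m => by positivity
  have hr1 : ∀ m : ℕ, 1 / ((m : ℝ) + 1) ≤ 1 := fun m => by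
    rw [div_le_one (by positivity)]; linarith [(Nat.cast_nonneg m : (0 : ℝ) ≤ m)]
  have hm := fun m => boxSet_add_smul_single_mem hI hw hmem (hr m).le (hr1 m)
  have h := tendsto_slope_direction hg hr tendsto_one_div_succ hm
  rw [inner_single] at h
  have hcoord : ∀ (m : ℕ) (j : Fin n),
      (w + (1 / ((m : ℝ) + 1)) • EuclideanSpace.single k s) j
        = if j = k then w k + 1 / ((m : ℝ) + 1) * s else w j := by
    intro m j
    by_cases h : j = k
    · subst h; simp
    · simp [h]
  rcases hs.lt_or_gt with hneg | hpos
  · have h1 : s * g k ≤ 0 := by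
      refine le_of_tendsto h (Filter.Eventually.of_forall fun m => ?_)
      refine mul_nonpos_of_nonneg_of_nonpos (inv_nonneg.2 (hr m).le) (sub_nonpos.2 ?_)
      refine hmono _ (hm m) _ hw fun j => ?_
      rw [hcoord]
      split_ifs with hj
      · subst hj; nlinarith [hr m]
      · exact le_rfl
    nlinarith
  · have h1 : 0 ≤ s * g k := by
      refine ge_of_tendsto h (Filter.Eventually.of_forall fun m => ?_)
      refine mul_nonneg (inv_nonneg.2 (hr m).le) (sub_nonneg.2 ?_)
      refine hmono _ hw _ (hm m) fun j => ?_
      rw [hcoord]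
      split_ifs with hj
      · subst hj; nlinarith [hr m]
      · exact le_rfl
    exact nonneg_of_mul_nonneg_right h1 hpos

theorem sub_le_mul_gradient (hI : ∀ k, IsClosedIntervalNonneg (I k))
    (hf : IsDRSubmodularOn f (boxSet I)) {w g : Vec n} (hw : w ∈ boxSet I)
    (hg : HasGradientWithinAt f g (boxSet I) w) (k : Fin n) {s : ℝ} (hs : 0 ≤ s)
    (hmem : w + EuclideanSpace.single k s ∈ boxSet I) :
    f (w + EuclideanSpace.single k s) - f w ≤ s * g k := by
  have hr : ∀ m : ℕ, 0 < 1 / ((m : ℝ) + 1) := fun m => by positivity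
  have hr1 : ∀ m : ℕ, 1 / ((m : ℝ) + 1) ≤ 1 := fun m => by
    rw [div_le_one (by positivity)]; linarith [(Nat.cast_nonneg m : (0 : ℝ) ≤ m)]
  have h := tendsto_slope_direction hg hr tendsto_one_div_succ
    (fun m => boxSet_add_smul_single_mem hI hw hmem (hr m).le (hr1 m))
  rw [inner_single] at h
  refine ge_of_tendsto h (Filter.Eventually.of_forall fun m => ?_)
  have e : ((m + 1 : ℕ) : ℝ) * (1 / ((m : ℝ) + 1) * s) = s := by
    push_cast; field_simp
  have e2 : (1 / ((m : ℝ) + 1)) • EuclideanSpace.single k s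
      = EuclideanSpace.single k (1 / ((m : ℝ) + 1) * s) := by
    ext j
    by_cases h : j = k
    · subst h; simp
    · simp [h]
  have h1 := sub_le_nsmul_of_dr hI hf hw k (s := 1 / ((m : ℝ) + 1) * s)
    (mul_nonneg (hr m).le hs) (m + 1) (by rw [e]; exact hmem)
  rw [e] at h1
  rw [e2, one_div, inv_inv, ← one_div]
  exact_mod_cast h1

/-- A DR-submodular function is dominated by its linearization in nonnegative directions. -/
theorem sub_le_inner_gradient (hI : ∀ k, IsClosedIntervalNonneg (I k))
    (hf : IsDRSubmodularOn f (boxSet I)) {w g v : Vec n} (hw : w ∈ boxSet I)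
    (hg : HasGradientWithinAt f g (boxSet I) w) (hv : ∀ k, 0 ≤ v k)
    (hwv : w + v ∈ boxSet I) : f (w + v) - f w ≤ ⟪g, v⟫ := by
  have hbet : ∀ p : Vec n, (∀ k, 0 ≤ p k) → (∀ k, p k ≤ v k) → w + p ∈ boxSet I := by
    intro p h1 h2
    refine boxSet_mem_of_between hI hw hwv (fun k => ?_) (fun k => ?_) <;>
      simp only [PiLp.add_apply] <;> linarith [h1 k, h2 k]
  have htr0 : ∀ j k, 0 ≤ truncVec v j k := by
    intro j k
    simp only [truncVec]
    split_ifs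
    · exact hv k
    · exact le_rfl
  have htr1 : ∀ j k, truncVec v j k ≤ v k := by
    intro j k
    simp only [truncVec]
    split_ifs
    · exact le_rfl
    · exact hv k
  have hsingle : ∀ k, w + EuclideanSpace.single k (v k) ∈ boxSet I := by
    intro k
    refine hbet _ (fun j => ?_) (fun j => ?_) <;> by_cases h : j = k
    · subst h; simpa using hv j
    · simp [h]
    · subst h; simp
    · simpa [h] using hv j
  have key : ∀ j ≤ n, f (w + truncVec v j) - f w ≤ ⟪g, truncVec v j⟫ := by
    intro j
    induction j with
    | zero => intro _; simp [truncVec_zero]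
    | succ j ih =>
      intro hj
      have h1 := ih (by omega)
      have h2 := truncVec_succ v ⟨j, hj⟩
      simp only at h2
      have hmem1 := hbet _ (htr0 j) (htr1 j)
      have hmem2 := hbet _ (htr0 (j + 1)) (htr1 (j + 1))
      rw [h2, ← add_assoc] at hmem2
      have h3 := hf.diminishing w hw (w + truncVec v j) hmem1
        (fun k => by simpa using htr0 j k) ⟨j, hj⟩ (v ⟨j, hj⟩) (hv _) (hsingle _) hmem2
      have h4 := sub_le_mul_gradient hI hf hw hg ⟨j, hj⟩ (hv _) (hsingle _)
      rw [h2, inner_add_right, inner_single, ← add_assoc]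
      linarith
  have := key n le_rfl
  rwa [truncVec_card] at this

/-- Replacing `y` by `y ∨ w - w` can only decrease the inner product with the gradient at `w`,
and `f (y ∨ w) ≥ f y`. -/
theorem sub_le_inner_gradient_of_mono (hI : ∀ k, IsClosedIntervalNonneg (I k))
    (hf : IsDRSubmodularOn f (boxSet I)) (hmono : IsMonotoneOn f (boxSet I))
    (h0 : (0 : Vec n) ∈ boxSet I) {w g y : Vec n} (hw : w ∈ boxSet I) (hy : y ∈ boxSet I)
    (hg : HasGradientWithinAt f g (boxSet I) w) : f y - f w ≤ ⟪y, g⟫ := by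
  set v : Vec n := WithLp.toLp 2 fun k => max (y k) (w k) - w k with hv
  have hvk : ∀ k, v k = max (y k) (w k) - w k := fun k => rfl
  have hwv : w + v ∈ boxSet I := by
    intro k
    simp only [PiLp.add_apply, hvk, add_sub_cancel]
    rcases max_choice (y k) (w k) with h | h <;> rw [h]
    · exact hy k
    · exact hw k
  have h1 := sub_le_inner_gradient hI hf hw hg (v := v)
    (fun k => by rw [hvk]; linarith [le_max_right (y k) (w k)]) hwv
  have h2 : f y ≤ f (w + v) := by
    refine hmono _ hy _ hwv fun k => ?_
    simp only [PiLp.add_apply, hvk, add_sub_cancel]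
    exact le_max_left _ _
  have h3 : ⟪g, v⟫ ≤ ⟪y, g⟫ := by
    rw [real_inner_comm g y]
    simp only [PiLp.inner_apply]
    refine Finset.sum_le_sum fun k _ => ?_
    simp only [RCLike.inner_apply, conj_trivial]
    have hy0 := (hI k).nonneg _ (hy k)
    have hw0 := (hI k).nonneg _ (hw k)
    have hmove : ∀ s : ℝ, w k + s ∈ I k → w + EuclideanSpace.single k s ∈ boxSet I := by
      intro s hs j
      rw [add_single_apply]
      split_ifs with hj
      · subst hj; exact hs
      · exact hw j
    rw [hvk]
    rcases lt_or_ge (w k) (y k) with h | h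
    · have hgk := gradient_nonneg hI hmono hw hg (k := k) (s := y k - w k) (by linarith)
        (hmove _ (by simpa using hy k))
      rw [max_eq_left h.le]
      nlinarith
    · rw [max_eq_right h, sub_self, zero_mul]
      rcases hw0.eq_or_lt with hw1 | hw1
      · have : y k = 0 := by linarith
        simp [this]
      · have hgk := gradient_nonneg hI hmono hw hg (k := k) (s := -w k) (by linarith)
          (hmove _ (by simpa using h0 k))
        positivity
  linarith

/-! ### The boosted gradient -/

theorem hasDerivAt_radial {X 𝒦 : Set (Vec n)} {gradf : Vec n → Vec n} {L : ℝ}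
    (hf : IsLSmoothOn L f gradf 𝒦 X) (h𝒦X : 𝒦 ⊆ X) {a : Vec n}
    (ha : ∀ s ∈ Set.Icc (0 : ℝ) 1, s • a ∈ 𝒦) {s : ℝ} (hs : s ∈ Set.Icc (0 : ℝ) 1) :
    HasDerivWithinAt (fun s : ℝ => f (s • a)) ⟪gradf (s • a), a⟫ (Set.Icc 0 1) s := by
  have h1 : HasDerivWithinAt (fun s : ℝ => s • a) a (Set.Icc 0 1) s := by
    simpa using (hasDerivWithinAt_id s (Set.Icc 0 1)).smul_const a
  have h2 := (hf.hasGradient _ (ha s hs)).hasFDerivWithinAt.comp_hasDerivWithinAt s h1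
    (fun r hr => h𝒦X (ha r hr))
  simpa [Function.comp_def] using h2

theorem IsLSmoothOn.continuousOn_gradient {X 𝒦 : Set (Vec n)} {gradf : Vec n → Vec n} {L : ℝ}
    (hf : IsLSmoothOn L f gradf 𝒦 X) (hL : 0 ≤ L) : ContinuousOn gradf 𝒦 := by
  have : LipschitzOnWith ⟨L, hL⟩ gradf 𝒦 :=
    LipschitzOnWith.of_dist_le_mul fun x hx y hy => by
      rw [dist_eq_norm, dist_eq_norm]; exact hf.lipschitz x hx y hy
  exact this.continuousOn

theorem one_sub_exp_neg_one_pos : 0 < 1 - Real.exp (-1) := by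
  have : Real.exp (-1) < 1 := by simp
  linarith

theorem integral_boostLaw (φ : ℝ → ℝ) :
    (1 - Real.exp (-1)) * ∫ s, φ s ∂boostLaw = ∫ s in (0 : ℝ)..1, Real.exp (s - 1) * φ s := by
  have hpos := one_sub_exp_neg_one_pos
  unfold boostLaw
  rw [integral_withDensity_eq_integral_toReal_smul (by fun_prop)
    (Filter.Eventually.of_forall fun _ => ENNReal.ofReal_lt_top),
    intervalIntegral.integral_of_le zero_le_one, ← integral_Icc_eq_integral_Ioc,
    ← integral_const_mul]
  refine integral_congr_ae (Filter.Eventually.of_forall fun s => ?_)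
  simp only
  rw [ENNReal.toReal_ofReal (by positivity), smul_eq_mul]
  field_simp

/-- Boosting: the average of `∇f (s b)` over the law of `Z` is an ascent direction for the
`(1 - 1/e)`-approximation at the nearby point `a`. The derivative of
`s ↦ e ^ (s - 1) * (f u - f (s a))` bounds the integrand below, up to a smoothness error whose
antiderivative is `(s - 1) * e ^ (s - 1)`. -/
theorem boost_inequality {𝒦 : Set (Vec n)} {gradf : Vec n → Vec n} {L R : ℝ}
    (hI : ∀ k, IsClosedIntervalNonneg (I k)) (h𝒦X : 𝒦 ⊆ boxSet I)
    (h𝒦 : Convex ℝ 𝒦) (h0 : (0 : Vec n) ∈ 𝒦) (hR : ∀ x ∈ 𝒦, ‖x‖ ≤ R) (hL : 0 ≤ L)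
    (hs : IsLSmoothOn L f gradf 𝒦 (boxSet I)) (hmono : IsMonotoneOn f (boxSet I))
    (hf : IsDRSubmodularOn f (boxSet I)) (hf0 : f 0 = 0) {a b u : Vec n} (ha : a ∈ 𝒦)
    (hb : b ∈ 𝒦) (hu : u ∈ 𝒦) :
    (1 - Real.exp (-1)) * f u - f a - 2 * R * L * Real.exp (-1) * ‖a - b‖
      ≤ (1 - Real.exp (-1)) * ∫ s, ⟪u - a, gradf (s • b)⟫ ∂boostLaw := by
  have hray : ∀ x ∈ 𝒦, ∀ s ∈ Set.Icc (0 : ℝ) 1, s • x ∈ 𝒦 := fun x hx s hs =>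
    h𝒦.smul_mem_of_zero_mem h0 hx hs
  rw [integral_boostLaw]
  set C : ℝ := 2 * R * L * ‖a - b‖ with hC
  set Ψ : ℝ → ℝ := fun s => Real.exp (s - 1) * (f u - f (s • a))
    - C * ((s - 1) * Real.exp (s - 1)) with hΨ
  set Ψ' : ℝ → ℝ := fun s => Real.exp (s - 1) * (f u - f (s • a))
    + Real.exp (s - 1) * (-⟪gradf (s • a), a⟫) - C * (s * Real.exp (s - 1)) with hΨ'
  have hexp : ∀ s : ℝ, HasDerivAt (fun s : ℝ => Real.exp (s - 1)) (Real.exp (s - 1)) s := by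
    intro s
    simpa using ((hasDerivAt_id s).sub_const 1).exp
  have hder : ∀ s ∈ Set.Icc (0 : ℝ) 1, HasDerivWithinAt Ψ (Ψ' s) (Set.Icc 0 1) s := by
    intro s hs'
    have h1 := (hexp s).hasDerivWithinAt.mul
      ((hasDerivAt_radial hs h𝒦X (hray a ha) hs').const_sub (f u))
    have h2 := ((((hasDerivAt_id s).sub_const 1).mul (hexp s)).const_mul C).hasDerivWithinAt
      (s := Set.Icc 0 1)
    refine (h1.sub h2).congr_deriv ?_
    simp only [hΨ', id]
    ring
  have key : Ψ 1 - Ψ 0 ≤ ∫ s in (0 : ℝ)..1, Real.exp (s - 1) * ⟪u - a, gradf (s • b)⟫ := by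
    refine intervalIntegral.sub_le_integral_of_hasDeriv_right_of_le zero_le_one
      (g' := Ψ') (fun s hs' => (hder s hs').continuousWithinAt) ?_ ?_ ?_
    · intro s hs'
      exact ((hder s (Set.Ioo_subset_Icc_self hs')).hasDerivAt
        (Icc_mem_nhds hs'.1 hs'.2)).hasDerivWithinAt
    · refine ContinuousOn.integrableOn_Icc ?_
      refine ContinuousOn.mul (by fun_prop) (continuousOn_const.inner ?_)
      exact (hs.continuousOn_gradient hL).comp (by fun_prop) (fun s hs' => hray b hb s hs')
    · intro s hs'
      have hs1 := Set.Ioo_subset_Icc_self hs'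
      have hE := Real.exp_pos (s - 1)
      have h1 := sub_le_inner_gradient_of_mono hI hf hmono (h𝒦X h0) (h𝒦X (hray a ha s hs1))
        (h𝒦X hu) (hs.hasGradient _ (hray a ha s hs1))
      have h2 : ⟪u - a, gradf (s • a)⟫ - C * s ≤ ⟪u - a, gradf (s • b)⟫ := by
        have h3 : ⟪u - a, gradf (s • a) - gradf (s • b)⟫ ≤ C * s := by
          calc _ ≤ ‖u - a‖ * ‖gradf (s • a) - gradf (s • b)‖ := real_inner_le_norm _ _
            _ ≤ (R + R) * (L * ‖s • a - s • b‖) := by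
              gcongr
              · linarith [(norm_nonneg _).trans (hR _ ha)]
              · exact (norm_sub_le _ _).trans (add_le_add (hR _ hu) (hR _ ha))
              · exact hs.lipschitz _ (hray a ha s hs1) _ (hray b hb s hs1)
            _ = C * s := by
              rw [← smul_sub, norm_smul, Real.norm_of_nonneg hs1.1, hC]; ring
        rw [inner_sub_right] at h3
        linarith
      have h4 : f u - f (s • a) - ⟪gradf (s • a), a⟫ - C * s ≤ ⟪u - a, gradf (s • b)⟫ := by
        rw [inner_sub_left, real_inner_comm (gradf (s • a)) a] at h2
        linarith
      simp only [hΨ']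
      nlinarith [mul_le_mul_of_nonneg_left h4 hE.le]
  refine le_trans (le_of_eq ?_) key
  simp only [hΨ, hC, one_smul, zero_smul, hf0, sub_self, Real.exp_zero, zero_sub]
  ring

end

/-! ### Contraction of the gossip matrix off the consensus direction -/

section
variable {N : ℕ} {Gr : SimpleGraph (Fin N)} {A : Matrix (Fin N) (Fin N) ℝ}

theorem dotProduct_eq_sum_eigenvectorBasis (hA : A.IsHermitian) (v w : Fin N → ℝ) :
    v ⬝ᵥ w = ∑ j, (hA.eigenvectorBasis j ⬝ᵥ v) * (hA.eigenvectorBasis j ⬝ᵥ w) := by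
  have h := hA.eigenvectorBasis.sum_inner_mul_inner (WithLp.toLp 2 v) (WithLp.toLp 2 w)
  simp only [EuclideanSpace.inner_eq_star_dotProduct, star_trivial] at h
  rw [dotProduct_comm v w, ← h]
  refine Finset.sum_congr rfl fun j _ => ?_
  rw [dotProduct_comm w]

theorem eigenvectorBasis_dotProduct_mulVec (hA : A.IsHermitian) (j : Fin N) (v : Fin N → ℝ) :
    hA.eigenvectorBasis j ⬝ᵥ A.mulVec v
      = hA.eigenvalues j * (hA.eigenvectorBasis j ⬝ᵥ v) := by
  have hT : A.transpose = A := by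
    rw [← Matrix.conjTranspose_eq_transpose_of_trivial]; exact hA
  have h := hA.mulVec_eigenvectorBasis j
  rw [Matrix.dotProduct_mulVec, ← Matrix.mulVec_transpose, hT, h, smul_dotProduct, smul_eq_mul]

theorem secondEigMagnitude_nonneg (hA : A.IsHermitian) : 0 ≤ secondEigMagnitude hA := by
  unfold secondEigMagnitude
  split_ifs
  · exact le_max_of_le_left (abs_nonneg _)
  · exact le_rfl

/-- All eigenvalues but one are bounded by `max |λ₂| |λ_N|`. -/
theorem exists_abs_eigenvalues_le (hA : A.IsHermitian) (hN : 0 < N) :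
    ∃ j₀, ∀ j ≠ j₀, |hA.eigenvalues j| ≤ secondEigMagnitude hA := by
  set e : Fin N ≃ Fin (Fintype.card (Fin N)) :=
    (Fintype.equivOfCardEq (Fintype.card_fin _)).symm with he
  have hc : Fintype.card (Fin N) = N := Fintype.card_fin N
  refine ⟨e.symm ⟨0, by omega⟩, fun j hj => ?_⟩
  have hj0 : (e j : ℕ) ≠ 0 := by
    intro h
    apply hj
    rw [Equiv.eq_symm_apply]
    exact Fin.ext h
  have hjN : (e j : ℕ) < N := by have := (e j).2; omega
  have h2 : 2 ≤ N := by omega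
  have hval : hA.eigenvalues j = hA.eigenvalues₀ (e j) := rfl
  unfold secondEigMagnitude
  rw [dif_pos h2, hval]
  have h3 : hA.eigenvalues₀ (e j) ≤ hA.eigenvalues₀ ⟨1, by omega⟩ :=
    hA.eigenvalues₀_antitone (by rw [Fin.le_def]; simp only; omega)
  have h4 : hA.eigenvalues₀ ⟨N - 1, by omega⟩ ≤ hA.eigenvalues₀ (e j) :=
    hA.eigenvalues₀_antitone (by rw [Fin.le_def]; simp only; omega)
  rw [abs_le]
  constructor
  · have := (neg_le_neg (le_max_right (|hA.eigenvalues₀ ⟨1, by omega⟩|)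
      (|hA.eigenvalues₀ ⟨N - 1, by omega⟩|))).trans (neg_abs_le _)
    linarith
  · exact h3.trans ((le_abs_self _).trans (le_max_left _ _))

/-- On vectors with zero sum, a gossip matrix contracts the Euclidean norm by `max |λ₂| |λ_N|`:
the constant vector is fixed, so it is orthogonal to all eigenvectors with eigenvalue below `1`
and spans the remaining eigendirection. -/
theorem IsGossipMatrix.sum_mulVec_sq_le (hA : IsGossipMatrix Gr A) (hN : 0 < N)
    (hβ1 : secondEigMagnitude hA.isHermitian < 1) {v : Fin N → ℝ} (hv : ∑ j, v j = 0) :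
    ∑ i, (A.mulVec v i) ^ 2 ≤ secondEigMagnitude hA.isHermitian ^ 2 * ∑ i, v i ^ 2 := by
  set hH := hA.isHermitian
  set β := secondEigMagnitude hH with hβ
  obtain ⟨j₀, hj₀⟩ := exists_abs_eigenvalues_le hH hN
  set c : (Fin N → ℝ) → Fin N → ℝ := fun w j => hH.eigenvectorBasis j ⬝ᵥ w with hc
  have hpars : ∀ w w' : Fin N → ℝ, w ⬝ᵥ w' = ∑ j, c w j * c w' j := fun w w' =>
    dotProduct_eq_sum_eigenvectorBasis hH w w'
  have hcA : ∀ w j, c (A.mulVec w) j = hH.eigenvalues j * c w j := fun w j =>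
    eigenvectorBasis_dotProduct_mulVec hH j w
  set one : Fin N → ℝ := fun _ => 1 with hone
  have hone0 : ∀ j ≠ j₀, c one j = 0 := by
    intro j hj
    have h1 := hcA one j
    rw [show A.mulVec one = one from hA.stochastic] at h1
    have h2 : hH.eigenvalues j < 1 := (le_abs_self _).trans_lt ((hj₀ j hj).trans_lt hβ1)
    have h3 : (1 - hH.eigenvalues j) * c one j = 0 := by linarith
    exact (mul_eq_zero.1 h3).resolve_left (by linarith)
  have hsum : ∀ w, one ⬝ᵥ w = c one j₀ * c w j₀ := by
    intro w
    rw [hpars]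
    exact Finset.sum_eq_single j₀ (fun j _ hj => by rw [hone0 j hj, zero_mul]) (by simp)
  have hc1 : c one j₀ ≠ 0 := by
    intro h
    have h1 := hsum one
    rw [h, zero_mul] at h1
    simp [hone, dotProduct] at h1
    omega
  have hv0 : c v j₀ = 0 := by
    have h1 := hsum v
    have h2 : one ⬝ᵥ v = 0 := by simpa [hone, dotProduct] using hv
    rw [h2] at h1
    exact (mul_eq_zero.1 h1.symm).resolve_left hc1
  have e1 : ∀ w : Fin N → ℝ, ∑ i, w i ^ 2 = ∑ j, c w j ^ 2 := by
    intro w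
    have := hpars w w
    simp only [dotProduct, ← sq] at this
    exact this
  rw [e1, e1 v, Finset.mul_sum]
  refine Finset.sum_le_sum fun j _ => ?_
  rw [hcA, mul_pow]
  by_cases hj : j = j₀
  · subst hj; simp [hv0]
  · have : hH.eigenvalues j ^ 2 ≤ β ^ 2 := by
      rw [← sq_abs]
      have := hj₀ j hj
      gcongr
    gcongr

variable {n : ℕ}

/-- One round of averaging with the weights `A`. -/
noncomputable def mix (A : Matrix (Fin N) (Fin N) ℝ) (w : Fin N → Vec n) (i : Fin N) : Vec n :=
  ∑ j, A i j • w j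

/-- The vectors held by the nodes, as one vector whose squared norm is `∑ i, ‖w i‖ ^ 2`. -/
noncomputable def stack (w : Fin N → Vec n) : PiLp 2 (fun _ : Fin N => Vec n) := WithLp.toLp 2 w

theorem norm_stack_sq (w : Fin N → Vec n) : ‖stack w‖ ^ 2 = ∑ i, ‖w i‖ ^ 2 :=
  PiLp.norm_sq_eq_of_L2 _ _

theorem IsGossipMatrix.norm_stack_mix_le (hA : IsGossipMatrix Gr A) (hN : 0 < N)
    (hβ1 : secondEigMagnitude hA.isHermitian < 1) {w : Fin N → Vec n} (hw : ∑ j, w j = 0) :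
    ‖stack (mix A w)‖ ≤ secondEigMagnitude hA.isHermitian * ‖stack w‖ := by
  refine le_of_sq_le_sq ?_ (mul_nonneg (secondEigMagnitude_nonneg _) (norm_nonneg _))
  rw [mul_pow, norm_stack_sq, norm_stack_sq]
  simp only [EuclideanSpace.norm_sq_eq, Real.norm_eq_abs, sq_abs]
  rw [Finset.sum_comm, Finset.sum_comm (f := fun i k => (w i k) ^ 2), Finset.mul_sum]
  refine Finset.sum_le_sum fun k _ => ?_
  have h := hA.sum_mulVec_sq_le hN hβ1 (v := fun j => w j k) (by
    have := congrArg (fun x : Vec n => x k) hw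
    simpa using this)
  refine le_trans (le_of_eq ?_) h
  refine Finset.sum_congr rfl fun i _ => ?_
  simp [mix, Matrix.mulVec, dotProduct]

theorem IsGossipMatrix.row_sum (hA : IsGossipMatrix Gr A) (i : Fin N) : ∑ j, A i j = 1 := by
  have := congrFun hA.stochastic i
  simpa [Matrix.mulVec, dotProduct] using this

theorem IsGossipMatrix.col_sum (hA : IsGossipMatrix Gr A) (j : Fin N) : ∑ i, A i j = 1 := by
  rw [← hA.row_sum j]
  exact Finset.sum_congr rfl fun i _ => hA.symm.apply j i

theorem IsGossipMatrix.sum_closedNbhd (hA : IsGossipMatrix Gr A) (w : Fin N → Vec n) (i : Fin N) :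
    ∑ j ∈ closedNbhd Gr i, A i j • w j = mix A w i := by
  refine Finset.sum_subset (Finset.subset_univ _) fun j _ hj => ?_
  have h0 : A i j = 0 := by
    refine le_antisymm (not_lt.1 fun h => hj ?_) (hA.nonneg i j)
    simpa [closedNbhd] using (hA.supported i j h).imp_right Eq.symm
  rw [h0, zero_smul]

theorem IsGossipMatrix.mix_mem (hA : IsGossipMatrix Gr A) {S : Set (Vec n)} (hS : Convex ℝ S)
    {w : Fin N → Vec n} (hw : ∀ j, w j ∈ S) (i : Fin N) : mix A w i ∈ S :=
  hS.sum_mem (fun j _ => hA.nonneg i j) (hA.row_sum i) (fun j _ => hw j)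

theorem IsGossipMatrix.sum_mix (hA : IsGossipMatrix Gr A) (w : Fin N → Vec n) :
    ∑ i, mix A w i = ∑ j, w j := by
  unfold mix
  rw [Finset.sum_comm]
  refine Finset.sum_congr rfl fun j _ => ?_
  rw [← Finset.sum_smul, hA.col_sum, one_smul]

theorem IsGossipMatrix.mix_sub_const (hA : IsGossipMatrix Gr A) (w : Fin N → Vec n) (u : Vec n)
    (i : Fin N) : mix A (fun j => w j - u) i = mix A w i - u := by
  unfold mix
  simp only [smul_sub, Finset.sum_sub_distrib]
  rw [← Finset.sum_smul, hA.row_sum, one_smul]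

theorem mix_sub (A : Matrix (Fin N) (Fin N) ℝ) (w w' : Fin N → Vec n) (i : Fin N) :
    mix A (fun j => w j - w' j) i = mix A w i - mix A w' i := by
  unfold mix
  simp only [smul_sub, Finset.sum_sub_distrib]

theorem IsGossipMatrix.norm_mix_le (hA : IsGossipMatrix Gr A) (w : Fin N → Vec n) (i : Fin N) :
    ‖mix A w i‖ ≤ ∑ j, A i j * ‖w j‖ := by
  refine (norm_sum_le _ _).trans (le_of_eq (Finset.sum_congr rfl fun j _ => ?_))
  rw [norm_smul, Real.norm_of_nonneg (hA.nonneg i j)]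

/-- Averaging does not increase the sum of squared norms (Jensen). -/
theorem IsGossipMatrix.sum_norm_mix_sq_le (hA : IsGossipMatrix Gr A) (w : Fin N → Vec n) :
    ∑ i, ‖mix A w i‖ ^ 2 ≤ ∑ j, ‖w j‖ ^ 2 := by
  have h1 : ∀ i, ‖mix A w i‖ ^ 2 ≤ ∑ j, A i j * ‖w j‖ ^ 2 := by
    intro i
    refine le_trans (pow_le_pow_left₀ (norm_nonneg _) (hA.norm_mix_le w i) 2) ?_
    exact Real.pow_arith_mean_le_arith_mean_pow Finset.univ (fun j => A i j) (fun j => ‖w j‖)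
      (fun j _ => hA.nonneg i j) (hA.row_sum i) (fun j _ => norm_nonneg _) 2
  refine (Finset.sum_le_sum fun i _ => h1 i).trans (le_of_eq ?_)
  rw [Finset.sum_comm]
  refine Finset.sum_congr rfl fun j _ => ?_
  rw [← Finset.sum_mul, hA.col_sum, one_mul]

end

/-! ### Deviation from the network average -/

section
variable {N n : ℕ} {Gr : SimpleGraph (Fin N)} {A : Matrix (Fin N) (Fin N) ℝ} {𝒦 : Set (Vec n)}

/-- The network average. -/
noncomputable def nodeAvg (w : Fin N → Vec n) : Vec n := (N : ℝ)⁻¹ • ∑ j, w j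

/-- Deviation of each node from the network average. -/
noncomputable def nodeDev (w : Fin N → Vec n) (i : Fin N) : Vec n := w i - nodeAvg w

theorem sum_nodeDev (hN : 0 < N) (w : Fin N → Vec n) : ∑ i, nodeDev w i = 0 := by
  have : (N : ℝ) ≠ 0 := by positivity
  simp only [nodeDev, nodeAvg, Finset.sum_sub_distrib, Finset.sum_const, Finset.card_univ,
    Fintype.card_fin]
  rw [← Nat.cast_smul_eq_nsmul ℝ, smul_smul, mul_inv_cancel₀ this, one_smul, sub_self]

theorem nodeDev_add (w w' : Fin N → Vec n) (i : Fin N) :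
    nodeDev (fun j => w j + w' j) i = nodeDev w i + nodeDev w' i := by
  simp only [nodeDev, nodeAvg, Finset.sum_add_distrib, smul_add]
  abel

theorem IsGossipMatrix.nodeDev_mix (hA : IsGossipMatrix Gr A) (w : Fin N → Vec n) (i : Fin N) :
    nodeDev (mix A w) i = mix A (nodeDev w) i := by
  have h := hA.mix_sub_const w (nodeAvg w) i
  unfold nodeDev at *
  rw [h]
  unfold nodeAvg
  rw [hA.sum_mix]

theorem norm_stack_nodeDev_le (hN : 0 < N) (w : Fin N → Vec n) :
    ‖stack (nodeDev w)‖ ≤ ‖stack w‖ := by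
  refine le_of_sq_le_sq ?_ (norm_nonneg _)
  rw [norm_stack_sq, norm_stack_sq]
  have h0 : ∑ i, ⟪nodeDev w i, nodeAvg w⟫ = 0 := by
    rw [← sum_inner, sum_nodeDev hN, inner_zero_left]
  have h1 : ∀ i, ‖w i‖ ^ 2
      = ‖nodeDev w i‖ ^ 2 + 2 * ⟪nodeDev w i, nodeAvg w⟫ + ‖nodeAvg w‖ ^ 2 := by
    intro i
    rw [← norm_add_sq_real]
    simp [nodeDev]
  simp only [h1, Finset.sum_add_distrib, ← Finset.mul_sum, h0]
  have : 0 ≤ ∑ _i : Fin N, ‖nodeAvg w‖ ^ 2 := Finset.sum_nonneg fun _ _ => sq_nonneg _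
  linarith

theorem norm_stack_le {w : Fin N → Vec n} {c : ℝ} (hc : 0 ≤ c) (hw : ∀ i, ‖w i‖ ≤ c) :
    ‖stack w‖ ≤ Real.sqrt N * c := by
  refine le_of_sq_le_sq ?_ (by positivity)
  rw [norm_stack_sq, mul_pow, Real.sq_sqrt (Nat.cast_nonneg _)]
  calc ∑ i, ‖w i‖ ^ 2 ≤ ∑ _i : Fin N, c ^ 2 := Finset.sum_le_sum fun i _ => by
        have := hw i; gcongr
    _ = N * c ^ 2 := by simp

theorem norm_le_norm_stack (w : Fin N → Vec n) (i : Fin N) : ‖w i‖ ≤ ‖stack w‖ := by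
  refine le_of_sq_le_sq ?_ (norm_nonneg _)
  rw [norm_stack_sq]
  exact Finset.single_le_sum (f := fun i => ‖w i‖ ^ 2) (fun _ _ => sq_nonneg _)
    (Finset.mem_univ i)

theorem sum_norm_le_norm_stack (w : Fin N → Vec n) :
    ∑ i, ‖w i‖ ≤ Real.sqrt N * ‖stack w‖ := by
  refine le_of_sq_le_sq ?_ (by positivity)
  rw [mul_pow, Real.sq_sqrt (Nat.cast_nonneg _), norm_stack_sq]
  simpa using sq_sum_le_card_mul_sum_sq (s := Finset.univ) (f := fun i => ‖w i‖)

/-! ### Gossip gradient ascent with infeasible projections -/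

/-- Trajectories `x`, `ỹ` of gossip ascent in the directions `d`, over `M` blocks: `ỹ` follows
`A ỹ + d` up to a move that brings it closer to all of `𝒦`, and `x` is a feasible point within
`σ` of `ỹ`. -/
structure GossipAscent (𝒦 : Set (Vec n)) (A : Matrix (Fin N) (Fin N) ℝ) (σ δ : ℝ) (M : ℕ)
    (x yt d : ℕ → Fin N → Vec n) : Prop where
  zero : ∀ i, yt 0 i = 0
  mem : ∀ m ≤ M, ∀ i, x m i ∈ 𝒦
  close : ∀ m ≤ M, ∀ i, ‖x m i - yt m i‖ ≤ σ
  bound : ∀ m < M, ∀ i, ‖d m i‖ ≤ δ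
  step : ∀ m < M, ∀ i, ∀ z ∈ 𝒦, ‖yt (m + 1) i - z‖ ≤ ‖mix A (yt m) i + d m i - z‖

namespace GossipAscent

variable {σ δ : ℝ} {M : ℕ} {x yt d : ℕ → Fin N → Vec n}

theorem norm_mix_sub_le (h : GossipAscent 𝒦 A σ δ M x yt d) (hA : IsGossipMatrix Gr A)
    {m : ℕ} (hm : m ≤ M) (i : Fin N) : ‖mix A (x m) i - mix A (yt m) i‖ ≤ σ := by
  rw [← mix_sub]
  refine (hA.norm_mix_le _ i).trans ?_
  calc ∑ j, A i j * ‖x m j - yt m j‖ ≤ ∑ j, A i j * σ :=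
        Finset.sum_le_sum fun j _ => mul_le_mul_of_nonneg_left (h.close m hm j) (hA.nonneg i j)
    _ = σ := by rw [← Finset.sum_mul, hA.row_sum, one_mul]

/-- The correction made by the infeasible projection, by comparison with the point `A x` of
`𝒦`. -/
theorem norm_correction_le (h : GossipAscent 𝒦 A σ δ M x yt d) (hA : IsGossipMatrix Gr A)
    (h𝒦 : Convex ℝ 𝒦) {m : ℕ} (hm : m < M) (i : Fin N) :
    ‖yt (m + 1) i - (mix A (yt m) i + d m i)‖ ≤ 2 * (σ + δ) := by
  have hz : mix A (x m) i ∈ 𝒦 := hA.mix_mem h𝒦 (h.mem m hm.le) i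
  have h1 := h.step m hm i _ hz
  have h2 : ‖mix A (yt m) i + d m i - mix A (x m) i‖ ≤ σ + δ := by
    have : mix A (yt m) i + d m i - mix A (x m) i
        = d m i - (mix A (x m) i - mix A (yt m) i) := by abel
    rw [this]
    refine (norm_sub_le _ _).trans ?_
    linarith [h.norm_mix_sub_le hA hm.le i, h.bound m hm i]
  have h3 : yt (m + 1) i - (mix A (yt m) i + d m i)
      = (yt (m + 1) i - mix A (x m) i) - (mix A (yt m) i + d m i - mix A (x m) i) := by abel
  rw [h3]
  refine (norm_sub_le _ _).trans ?_
  linarith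

/-- Geometric decay of disagreement keeps the nodes within `√N (2σ + 3δ) / (1 - β)` of their
average. -/
theorem norm_stack_nodeDev_le (h : GossipAscent 𝒦 A σ δ M x yt d) (hA : IsGossipMatrix Gr A)
    (h𝒦 : Convex ℝ 𝒦) (hN : 0 < N) (hσ : 0 ≤ σ) (hδ : 0 ≤ δ)
    (hβ1 : secondEigMagnitude hA.isHermitian < 1) {m : ℕ} (hm : m ≤ M) :
    ‖stack (nodeDev (yt m))‖
      ≤ Real.sqrt N * ((2 * σ + 3 * δ) / (1 - secondEigMagnitude hA.isHermitian)) := by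
  set β := secondEigMagnitude hA.isHermitian with hβ
  have hβ0 : 0 ≤ β := secondEigMagnitude_nonneg _
  set B := (2 * σ + 3 * δ) / (1 - β) with hB
  have hBeq : β * B + (2 * σ + 3 * δ) = B := by
    rw [hB]
    field_simp [(by linarith : (1 - β) ≠ 0)]
    ring
  have hB0 : 0 ≤ B := div_nonneg (by linarith) (by linarith)
  induction m with
  | zero =>
    refine (_root_.norm_stack_nodeDev_le hN _).trans (norm_stack_le hB0 fun i => ?_)
    rw [h.zero, norm_zero]; exact hB0
  | succ m ih =>
    have hm' : m < M := hm
    set p : Fin N → Vec n := fun i => yt (m + 1) i - mix A (yt m) i with hp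
    have e : nodeDev (yt (m + 1)) = fun i => mix A (nodeDev (yt m)) i + nodeDev p i := by
      funext i
      rw [← hA.nodeDev_mix, ← nodeDev_add]
      congr 1
      funext j
      simp [hp]
    have e2 : stack (nodeDev (yt (m + 1))) = stack (mix A (nodeDev (yt m))) + stack (nodeDev p) := by
      rw [e]; rfl
    have hp1 : ∀ i, ‖p i‖ ≤ 2 * σ + 3 * δ := by
      intro i
      have e3 : p i = (yt (m + 1) i - (mix A (yt m) i + d m i)) + d m i := by
        simp only [hp]; abel
      rw [e3]
      refine (norm_add_le _ _).trans ?_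
      linarith [h.norm_correction_le hA h𝒦 hm' i, h.bound m hm' i]
    rw [e2]
    calc _ ≤ ‖stack (mix A (nodeDev (yt m)))‖ + ‖stack (nodeDev p)‖ := norm_add_le _ _
      _ ≤ β * (Real.sqrt N * B) + Real.sqrt N * (2 * σ + 3 * δ) := by
        refine add_le_add ?_ ?_
        · refine (hA.norm_stack_mix_le hN hβ1 (sum_nodeDev hN _)).trans ?_
          exact mul_le_mul_of_nonneg_left (ih hm'.le) hβ0
        · exact (_root_.norm_stack_nodeDev_le hN _).trans (norm_stack_le (by linarith) hp1)
      _ = Real.sqrt N * (β * B + (2 * σ + 3 * δ)) := by ring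
      _ = Real.sqrt N * B := by rw [hBeq]

/-- Total disagreement of the nodes with the decision of node `i`. -/
theorem sum_norm_sub_le (h : GossipAscent 𝒦 A σ δ M x yt d) (hA : IsGossipMatrix Gr A)
    (h𝒦 : Convex ℝ 𝒦) (hN : 0 < N) (hσ : 0 ≤ σ) (hδ : 0 ≤ δ)
    (hβ1 : secondEigMagnitude hA.isHermitian < 1) {m : ℕ} (hm : m ≤ M) (i : Fin N) :
    ∑ j, ‖x m j - x m i‖ ≤ N * (2 * σ + (Real.sqrt N + 1)
      * ((2 * σ + 3 * δ) / (1 - secondEigMagnitude hA.isHermitian))) := by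
  set B := (2 * σ + 3 * δ) / (1 - secondEigMagnitude hA.isHermitian)
  have hV := h.norm_stack_nodeDev_le hA h𝒦 hN hσ hδ hβ1 hm
  set V := ‖stack (nodeDev (yt m))‖
  have hs := Real.sq_sqrt (Nat.cast_nonneg N : (0 : ℝ) ≤ N)
  have hs0 := Real.sqrt_nonneg (N : ℝ)
  have h1 : ∀ j, ‖x m j - x m i‖ ≤ 2 * σ + ‖nodeDev (yt m) j‖ + V := by
    intro j
    have e : x m j - x m i = (x m j - yt m j) + nodeDev (yt m) j
        - ((x m i - yt m i) + nodeDev (yt m) i) := by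
      simp only [nodeDev]; abel
    rw [e]
    refine (norm_sub_le _ _).trans ?_
    have a1 := norm_add_le (x m j - yt m j) (nodeDev (yt m) j)
    have a2 := norm_add_le (x m i - yt m i) (nodeDev (yt m) i)
    linarith [h.close m hm j, h.close m hm i, norm_le_norm_stack (nodeDev (yt m)) i]
  calc ∑ j, ‖x m j - x m i‖ ≤ ∑ j, (2 * σ + ‖nodeDev (yt m) j‖ + V) :=
        Finset.sum_le_sum fun j _ => h1 j
    _ = N * (2 * σ) + ∑ j, ‖nodeDev (yt m) j‖ + N * V := by
        simp [Finset.sum_add_distrib]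
    _ ≤ N * (2 * σ) + Real.sqrt N * V + N * V := by
        gcongr; exact sum_norm_le_norm_stack _
    _ ≤ N * (2 * σ) + Real.sqrt N * (Real.sqrt N * B) + N * (Real.sqrt N * B) := by
        gcongr
    _ = N * (2 * σ + (Real.sqrt N + 1) * B) := by
        rw [← mul_assoc (Real.sqrt N), ← sq, hs]; ring

/-- The potential `∑ i, ‖ỹ i - u‖ ^ 2` controls the regret of the mixed infeasible points. -/
theorem sum_inner_mix_le (h : GossipAscent 𝒦 A σ δ M x yt d) (hA : IsGossipMatrix Gr A)
    {u : Vec n} (hu : u ∈ 𝒦) :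
    2 * ∑ m ∈ Finset.range M, ∑ j, ⟪d m j, u - mix A (yt m) j⟫
      ≤ N * ‖u‖ ^ 2 + M * (N * δ ^ 2) := by
  set Φ : ℕ → ℝ := fun m => ∑ j, ‖yt m j - u‖ ^ 2 with hΦ
  have hstep : ∀ m < M, 2 * ∑ j, ⟪d m j, u - mix A (yt m) j⟫ ≤ Φ m - Φ (m + 1) + N * δ ^ 2 := by
    intro m hm
    have h1 : ∀ j, ‖yt (m + 1) j - u‖ ^ 2 ≤ ‖mix A (fun k => yt m k - u) j‖ ^ 2
        - 2 * ⟪d m j, u - mix A (yt m) j⟫ + δ ^ 2 := by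
      intro j
      have a1 := h.step m hm j u hu
      have a2 : mix A (yt m) j + d m j - u = (mix A (yt m) j - u) + d m j := by abel
      have a3 := h.bound m hm j
      have a4 : ⟪mix A (yt m) j - u, d m j⟫ = - ⟪d m j, u - mix A (yt m) j⟫ := by
        rw [real_inner_comm, ← inner_neg_right, neg_sub]
      calc ‖yt (m + 1) j - u‖ ^ 2 ≤ ‖mix A (yt m) j + d m j - u‖ ^ 2 := by gcongr
        _ = ‖mix A (yt m) j - u‖ ^ 2 - 2 * ⟪d m j, u - mix A (yt m) j⟫ + ‖d m j‖ ^ 2 := by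
          rw [a2, norm_add_sq_real, a4]; ring
        _ ≤ _ := by
          rw [hA.mix_sub_const]
          gcongr
    have h2 := Finset.sum_le_sum fun j (_ : j ∈ Finset.univ) => h1 j
    simp only [Finset.sum_add_distrib, Finset.sum_sub_distrib, ← Finset.mul_sum, Finset.sum_const,
      Finset.card_univ, Fintype.card_fin, nsmul_eq_mul] at h2
    have h3 := hA.sum_norm_mix_sq_le (fun k => yt m k - u)
    simp only [hΦ]
    linarith
  have hsum := Finset.sum_le_sum fun m (hm : m ∈ Finset.range M) =>
    hstep m (Finset.mem_range.1 hm)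
  rw [← Finset.mul_sum, Finset.sum_add_distrib, Finset.sum_range_sub'] at hsum
  have h0 : Φ 0 = N * ‖u‖ ^ 2 := by
    simp [hΦ, h.zero]
  have hM : 0 ≤ Φ M := Finset.sum_nonneg fun _ _ => sq_nonneg _
  simp only [Finset.sum_const, Finset.card_range, nsmul_eq_mul] at hsum
  linarith

/-- Regret of the decisions of node `i` against `u`, for the linear functions `d`. -/
theorem sum_inner_le (h : GossipAscent 𝒦 A σ δ M x yt d) (hA : IsGossipMatrix Gr A)
    (h𝒦 : Convex ℝ 𝒦) (hN : 0 < N) (hσ : 0 ≤ σ) (hδ : 0 ≤ δ)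
    (hβ1 : secondEigMagnitude hA.isHermitian < 1) {u : Vec n} (hu : u ∈ 𝒦) (i : Fin N) :
    ∑ m ∈ Finset.range M, ∑ j, ⟪d m j, u - x m i⟫
      ≤ N * (‖u‖ ^ 2 / 2 + M * δ ^ 2 / 2 + M * δ * (3 * σ + (Real.sqrt N + 1)
        * ((2 * σ + 3 * δ) / (1 - secondEigMagnitude hA.isHermitian)))) := by
  set B := (2 * σ + 3 * δ) / (1 - secondEigMagnitude hA.isHermitian)
  have h1 := h.sum_inner_mix_le hA hu
  have h2 : ∀ m < M, ∑ j, ⟪d m j, mix A (yt m) j - x m i⟫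
      ≤ N * (δ * (3 * σ + (Real.sqrt N + 1) * B)) := by
    intro m hm
    have hdis := h.sum_norm_sub_le hA h𝒦 hN hσ hδ hβ1 hm.le i
    have h3 : ∀ j, ‖mix A (yt m) j - x m i‖ ≤ σ + ∑ k, A j k * ‖x m k - x m i‖ := by
      intro j
      have e : mix A (yt m) j - x m i
          = mix A (fun k => x m k - x m i) j - (mix A (x m) j - mix A (yt m) j) := by
        rw [hA.mix_sub_const]; abel
      rw [e]
      refine (norm_sub_le _ _).trans ?_
      linarith [h.norm_mix_sub_le hA hm.le j, hA.norm_mix_le (fun k => x m k - x m i) j]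
    calc ∑ j, ⟪d m j, mix A (yt m) j - x m i⟫
        ≤ ∑ j, δ * (σ + ∑ k, A j k * ‖x m k - x m i‖) := by
          refine Finset.sum_le_sum fun j _ => (real_inner_le_norm _ _).trans ?_
          exact mul_le_mul (h.bound m hm j) (h3 j) (norm_nonneg _) hδ
      _ = δ * (N * σ + ∑ k, ‖x m k - x m i‖) := by
          rw [← Finset.mul_sum, Finset.sum_add_distrib, Finset.sum_comm]
          simp only [← Finset.sum_mul, hA.col_sum, one_mul]
          simp
      _ ≤ δ * (N * σ + N * (2 * σ + (Real.sqrt N + 1) * B)) := by gcongr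
      _ = _ := by ring
  have h4 := Finset.sum_le_sum fun m (hm : m ∈ Finset.range M) => h2 m (Finset.mem_range.1 hm)
  simp only [Finset.sum_const, Finset.card_range, nsmul_eq_mul] at h4
  have e : ∑ m ∈ Finset.range M, ∑ j, ⟪d m j, u - x m i⟫
      = ∑ m ∈ Finset.range M, ∑ j, ⟪d m j, u - mix A (yt m) j⟫
        + ∑ m ∈ Finset.range M, ∑ j, ⟪d m j, mix A (yt m) j - x m i⟫ := by
    simp only [← Finset.sum_add_distrib, ← inner_add_right]
    refine Finset.sum_congr rfl fun m _ => Finset.sum_congr rfl fun j _ => ?_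
    congr 1
    abel
  rw [e]
  linarith

end GossipAscent

end

/-! ### A run of the algorithm for fixed randomness -/

section
variable {N n : ℕ} {Gr : SimpleGraph (Fin N)} {A : Matrix (Fin N) (Fin N) ℝ} {𝒦 : Set (Vec n)}
  {lo : Vec n → Vec n} {R G ε η : ℝ} {K : ℕ} {Ξ : Type*}
  {sg : ℕ → Fin N → Vec n → Ξ → Vec n} {z : ℕ → Fin N → ℝ} {ξ : ℕ → Fin N → Ξ}

/-- The boosted stochastic gradient collected by node `i` in round `t`, when it plays `x`. -/
noncomputable def boostedGrad (sg : ℕ → Fin N → Vec n → Ξ → Vec n) (z : ℕ → Fin N → ℝ)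
    (ξ : ℕ → Fin N → Ξ) (t : ℕ) (i : Fin N) (x : Vec n) : Vec n :=
  (1 - Real.exp (-1)) • sg t i (z t i • x) (ξ t i)

theorem IsGossipMatrix.dpobga_succ (hA : IsGossipMatrix Gr A) (m : ℕ) (i : Fin N) :
    dpobga lo R ε η K Gr A sg z ξ (m + 1) i =
      let s := dpobga lo R ε η K Gr A sg z ξ m
      let o := infeasibleProj lo R (mix A (fun j => (s j).x) i)
        (mix A (fun j => (s j).yt) i
          + η • ∑ t ∈ Finset.Ico (m * K) ((m + 1) * K), boostedGrad sg z ξ t i (s i).x) ε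
      ⟨o.x, o.yt, (s i).loSteps + o.cost, (s i).comms + 1⟩ := by
  simp only [dpobga, hA.sum_closedNbhd, boostedGrad]

theorem norm_boostedGrad_le (h𝒦 : Convex ℝ 𝒦) (h0 : (0 : Vec n) ∈ 𝒦) {t : ℕ} {i : Fin N}
    (hz : z t i ∈ Set.Icc (0 : ℝ) 1) (hsg : ∀ x ∈ 𝒦, ∀ s, ‖sg t i x s‖ ≤ G) {x : Vec n}
    (hx : x ∈ 𝒦) : ‖boostedGrad sg z ξ t i x‖ ≤ (1 - Real.exp (-1)) * G := by
  unfold boostedGrad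
  rw [norm_smul, Real.norm_of_nonneg one_sub_exp_neg_one_pos.le]
  exact mul_le_mul_of_nonneg_left (hsg _ (h𝒦.smul_mem_of_zero_mem h0 hx hz) _)
    one_sub_exp_neg_one_pos.le

/-- State of all nodes after `m` blocks: feasible decisions, close to the infeasible points, at
most `K` linear optimization steps per block. -/
structure RunInv (𝒦 : Set (Vec n)) (ε : ℝ) (K m : ℕ) (s : Fin N → NodeState n) : Prop where
  mem : ∀ i, (s i).x ∈ 𝒦
  close : ∀ i, ‖(s i).x - (s i).yt‖ ^ 2 ≤ 3 * ε
  loSteps : ∀ i, (s i).loSteps ≤ ((m * K : ℕ) : ℕ∞)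
  comms : ∀ i, (s i).comms = m

theorem norm_mix_sub_target_le (hA : IsGossipMatrix Gr A) {σ δ : ℝ} {s : Fin N → NodeState n}
    (hs : ∀ i, ‖(s i).x - (s i).yt‖ ≤ σ) {d : Vec n} (hd : ‖d‖ ≤ δ) (i : Fin N) :
    ‖mix A (fun j => (s j).x) i - (mix A (fun j => (s j).yt) i + d)‖ ≤ σ + δ := by
  have e : mix A (fun j => (s j).x) i - (mix A (fun j => (s j).yt) i + d)
      = mix A (fun j => (s j).x - (s j).yt) i - d := by
    rw [mix_sub]; abel
  rw [e]
  refine (norm_sub_le _ _).trans (add_le_add ?_ hd)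
  refine (hA.norm_mix_le _ i).trans ?_
  calc _ ≤ ∑ j, A i j * σ :=
        Finset.sum_le_sum fun j _ => mul_le_mul_of_nonneg_left (hs j) (hA.nonneg i j)
    _ = σ := by rw [← Finset.sum_mul, hA.row_sum, one_mul]

/-- One block: the infeasible projection meets its specification and costs at most `K` linear
optimization steps. The hypotheses on the parameters say that the input of the infeasible
projection is at squared distance at most `8 ε`, and that either its general cost bound is at
most `K` or the ball is so small that no Frank–Wolfe step is made. -/
theorem infeasibleProj_block (hA : IsGossipMatrix Gr A) (h𝒦 : Convex ℝ 𝒦)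
    (hR : ∀ x ∈ 𝒦, ‖x‖ ≤ R) (hlo : IsLinOpt 𝒦 lo) {σ δ : ℝ}
    (hD : (σ + δ) ^ 2 ≤ 8 * ε) (hD0 : R = 0 → (σ + δ) ^ 2 ≤ 3 * ε) (hK : 1 ≤ K)
    (hcost : 17 * (⌊16 * R ^ 2 / ε + 1⌋₊ + 1) ≤ K ∨ 4 * R ^ 2 ≤ 3 * ε)
    {s : Fin N → NodeState n} (hmem : ∀ i, (s i).x ∈ 𝒦)
    (hs : ∀ i, ‖(s i).x - (s i).yt‖ ≤ σ) {d : Vec n} (hd : ‖d‖ ≤ δ) (i : Fin N) :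
    IPGood 𝒦 ε (mix A (fun j => (s j).yt) i + d)
        (infeasibleProj lo R (mix A (fun j => (s j).x) i)
          (mix A (fun j => (s j).yt) i + d) ε) ∧
      (infeasibleProj lo R (mix A (fun j => (s j).x) i)
          (mix A (fun j => (s j).yt) i + d) ε).cost ≤ (K : ℕ∞) := by
  have hx₀ : mix A (fun j => (s j).x) i ∈ 𝒦 := hA.mix_mem h𝒦 hmem i
  have h1 := norm_mix_sub_target_le hA hs hd i
  have h2 : ‖mix A (fun j => (s j).x) i - (mix A (fun j => (s j).yt) i + d)‖ ^ 2
      ≤ (σ + δ) ^ 2 := by gcongr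
  obtain ⟨g, c⟩ := infeasibleProj_spec h𝒦 hR hlo hx₀ (h2.trans hD) (fun h => h2.trans (hD0 h))
  refine ⟨g, ?_⟩
  rcases hcost with h | h
  · exact c.trans (by exact_mod_cast h)
  · refine (infeasibleProj_cost_le_one hR hx₀ (fun h => h2.trans (hD0 h)) h).trans ?_
    exact_mod_cast hK

/-- The sum of the boosted gradients of a block. -/
noncomputable def blockGrad (sg : ℕ → Fin N → Vec n → Ξ → Vec n) (z : ℕ → Fin N → ℝ)
    (ξ : ℕ → Fin N → Ξ) (K m : ℕ) (i : Fin N) (x : Vec n) : Vec n :=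
  ∑ t ∈ Finset.Ico (m * K) ((m + 1) * K), boostedGrad sg z ξ t i x

theorem mem_block_lt {M m t : ℕ} (hm : m < M) (ht : t ∈ Finset.Ico (m * K) ((m + 1) * K)) :
    t < M * K :=
  (Finset.mem_Ico.1 ht).2.trans_le (Nat.mul_le_mul_right K hm)

theorem norm_blockGrad_le (h𝒦 : Convex ℝ 𝒦) (h0 : (0 : Vec n) ∈ 𝒦) {M : ℕ}
    (hz : ∀ t < M * K, ∀ i, z t i ∈ Set.Icc (0 : ℝ) 1)
    (hsg : ∀ t < M * K, ∀ i, ∀ x ∈ 𝒦, ∀ s, ‖sg t i x s‖ ≤ G) {m : ℕ} (hm : m < M) (i : Fin N)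
    {x : Vec n} (hx : x ∈ 𝒦) :
    ‖blockGrad sg z ξ K m i x‖ ≤ K * ((1 - Real.exp (-1)) * G) := by
  unfold blockGrad
  refine (norm_sum_le _ _).trans ?_
  calc _ ≤ ∑ _t ∈ Finset.Ico (m * K) ((m + 1) * K), (1 - Real.exp (-1)) * G :=
        Finset.sum_le_sum fun t ht => norm_boostedGrad_le h𝒦 h0 (hz t (mem_block_lt hm ht) i)
          (hsg t (mem_block_lt hm ht) i) hx
    _ = K * ((1 - Real.exp (-1)) * G) := by
        rw [Finset.sum_const, Nat.card_Ico, nsmul_eq_mul, add_mul, one_mul,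
          Nat.add_sub_cancel_left]

/-- The deterministic hypotheses under which `M` blocks of the algorithm are analysed: the
decision set, the oracle, bounded gradients, and the two properties of the parameters needed by
`infeasibleProj_block`. -/
structure RunSetup (Gr : SimpleGraph (Fin N)) (A : Matrix (Fin N) (Fin N) ℝ) (𝒦 : Set (Vec n))
    (lo : Vec n → Vec n) (R G ε η : ℝ) (K M : ℕ) (sg : ℕ → Fin N → Vec n → Ξ → Vec n)
    (z : ℕ → Fin N → ℝ) : Prop where
  gossip : IsGossipMatrix Gr A
  convex : Convex ℝ 𝒦
  zero_mem : (0 : Vec n) ∈ 𝒦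
  norm_le : ∀ x ∈ 𝒦, ‖x‖ ≤ R
  linOpt : IsLinOpt 𝒦 lo
  eps_nonneg : 0 ≤ ε
  eta_nonneg : 0 ≤ η
  target : (Real.sqrt (3 * ε) + η * (K * ((1 - Real.exp (-1)) * G))) ^ 2 ≤ 8 * ε
  target_zero : R = 0 →
    (Real.sqrt (3 * ε) + η * (K * ((1 - Real.exp (-1)) * G))) ^ 2 ≤ 3 * ε
  one_le : 1 ≤ K
  cost : 17 * (⌊16 * R ^ 2 / ε + 1⌋₊ + 1) ≤ K ∨ 4 * R ^ 2 ≤ 3 * ε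
  scale_mem : ∀ t < M * K, ∀ i, z t i ∈ Set.Icc (0 : ℝ) 1
  grad_bound : ∀ t < M * K, ∀ i, ∀ x ∈ 𝒦, ∀ s, ‖sg t i x s‖ ≤ G

namespace RunSetup

variable {M : ℕ}

theorem norm_smul_blockGrad_le (h : RunSetup Gr A 𝒦 lo R G ε η K M sg z) {m : ℕ} (hm : m < M)
    (i : Fin N) {x : Vec n} (hx : x ∈ 𝒦) :
    ‖η • blockGrad sg z ξ K m i x‖ ≤ η * (K * ((1 - Real.exp (-1)) * G)) := by
  rw [norm_smul, Real.norm_of_nonneg h.eta_nonneg]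
  exact mul_le_mul_of_nonneg_left
    (norm_blockGrad_le h.convex h.zero_mem h.scale_mem h.grad_bound hm i hx) h.eta_nonneg

theorem block (h : RunSetup Gr A 𝒦 lo R G ε η K M sg z) {m : ℕ} (hm : m < M)
    (hI : RunInv 𝒦 ε K m (dpobga lo R ε η K Gr A sg z ξ m)) (i : Fin N) :
    let s := dpobga lo R ε η K Gr A sg z ξ m
    let y := mix A (fun j => (s j).yt) i + η • blockGrad sg z ξ K m i (s i).x
    let o := infeasibleProj lo R (mix A (fun j => (s j).x) i) y ε
    IPGood 𝒦 ε y o ∧ o.cost ≤ (K : ℕ∞) := by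
  refine infeasibleProj_block h.gossip h.convex h.norm_le h.linOpt h.target h.target_zero h.one_le
    h.cost hI.mem (fun j => ?_) (h.norm_smul_blockGrad_le hm i (hI.mem i)) i
  exact Real.le_sqrt_of_sq_le (hI.close j)

theorem inv (h : RunSetup Gr A 𝒦 lo R G ε η K M sg z) :
    ∀ m ≤ M, RunInv 𝒦 ε K m (dpobga lo R ε η K Gr A sg z ξ m) := by
  intro m
  induction m with
  | zero =>
    intro _
    have hε := h.eps_nonneg
    refine ⟨fun i => h.zero_mem, fun i => ?_, fun i => ?_, fun i => rfl⟩
    · simpa [dpobga] using hε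
    · simp [dpobga]
  | succ m ih =>
    intro hm
    have hI := ih (by omega)
    have hb := h.block (ξ := ξ) hm hI
    refine ⟨fun i => ?_, fun i => ?_, fun i => ?_, fun i => ?_⟩ <;> rw [h.gossip.dpobga_succ]
    · exact (hb i).1.mem
    · exact (hb i).1.close
    · refine (add_le_add (hI.loSteps i) (hb i).2).trans (le_of_eq ?_)
      rw [← Nat.cast_add, Nat.succ_mul]
    · simp only [hI.comms i]

theorem gossipAscent (h : RunSetup Gr A 𝒦 lo R G ε η K M sg z) :
    GossipAscent 𝒦 A (Real.sqrt (3 * ε)) (η * (K * ((1 - Real.exp (-1)) * G))) M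
      (fun m i => (dpobga lo R ε η K Gr A sg z ξ m i).x)
      (fun m i => (dpobga lo R ε η K Gr A sg z ξ m i).yt)
      (fun m i => η • blockGrad sg z ξ K m i (dpobga lo R ε η K Gr A sg z ξ m i).x) := by
  refine ⟨fun i => rfl, fun m hm i => (h.inv m hm).mem i, fun m hm i => ?_,
    fun m hm i => h.norm_smul_blockGrad_le hm i ((h.inv m hm.le).mem i), fun m hm i p hp => ?_⟩
  · exact Real.le_sqrt_of_sq_le ((h.inv m hm).close i)
  · have hb := (h.block (ξ := ξ) hm (h.inv m hm.le) i).1.dist p hp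
    simp only [h.gossip.dpobga_succ m]
    exact hb

end RunSetup

/-! ### The parameters of the theorem -/

/-- The powers of `T` in terms of `τ = T ^ (1 / 4)`. -/
theorem exists_fourth_root {T K : ℕ} (hT : 0 < T) (hK : (K : ℝ) = Real.sqrt T) :
    ∃ τ : ℝ, 0 < τ ∧ (K : ℝ) = τ ^ 2 ∧ (T : ℝ) = τ ^ 4 ∧ (T : ℝ) ^ (3 / 4 : ℝ) = τ ^ 3 ∧
      (T : ℝ) ^ (-(3 / 4) : ℝ) = 1 / τ ^ 3 ∧ (T : ℝ) ^ (-(1 / 2) : ℝ) = 1 / τ ^ 2 := by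
  have hT' : (0 : ℝ) < T := by exact_mod_cast hT
  set τ : ℝ := (T : ℝ) ^ (1 / 4 : ℝ) with hτ
  have hpow : ∀ k : ℕ, τ ^ k = (T : ℝ) ^ ((k : ℝ) / 4) := by
    intro k
    rw [hτ, ← Real.rpow_natCast, ← Real.rpow_mul hT'.le]
    congr 1
    ring
  refine ⟨τ, Real.rpow_pos_of_pos hT' _, ?_, ?_, ?_, ?_, ?_⟩
  · rw [hK, hpow, Real.sqrt_eq_rpow]; norm_num
  · rw [hpow]; norm_num
  · rw [hpow]; norm_num
  · rw [hpow, Real.rpow_neg hT'.le]; norm_num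
  · rw [hpow, Real.rpow_neg hT'.le]; norm_num

theorem eq_sq_of_sqrt {T K : ℕ} (hK : (K : ℝ) = Real.sqrt T) : T = K * K := by
  have h : ((K * K : ℕ) : ℝ) = T := by
    push_cast
    rw [hK, Real.mul_self_sqrt (Nat.cast_nonneg _)]
  exact_mod_cast h.symm

/-- The cost of a block. When `K ≤ 303`, the tolerance `3 ε` exceeds the squared diameter of the
ball and no Frank–Wolfe step is made. -/
theorem cost_condition {K : ℕ} {R ε : ℝ} (hK : 0 < K) (hR : 0 < R)
    (hε : ε = 405 * R ^ 2 / K) :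
    17 * (⌊16 * R ^ 2 / ε + 1⌋₊ + 1) ≤ K ∨ 4 * R ^ 2 ≤ 3 * ε := by
  have hK' : (0 : ℝ) < K := by exact_mod_cast hK
  rcases le_total K 303 with h | h
  · right
    have h' : (K : ℝ) ≤ 303 := by exact_mod_cast h
    rw [hε, ← mul_div_assoc, le_div_iff₀ hK']
    nlinarith [sq_nonneg R]
  · left
    have h' : (303 : ℝ) ≤ K := by exact_mod_cast h
    have e : 16 * R ^ 2 / ε = 16 * K / 405 := by
      rw [hε]; field_simp
    have h1 : ((⌊16 * R ^ 2 / ε + 1⌋₊ : ℕ) : ℝ) ≤ 16 * R ^ 2 / ε + 1 :=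
      Nat.floor_le (by rw [e]; positivity)
    rw [e] at h1
    have h2 : ((17 * (⌊16 * R ^ 2 / ε + 1⌋₊ + 1) : ℕ) : ℝ) ≤ K := by
      push_cast
      rw [e]
      linarith
    exact_mod_cast h2

/-- `√(3ε) ≤ 34.9 R T ^ (-1/4)`, as `√1215 < 34.9`. -/
theorem sqrt_tolerance_le {R τ : ℝ} (hR : 0 ≤ R) (hτ : 0 < τ) :
    Real.sqrt (3 * (405 * R ^ 2 * (1 / τ ^ 2))) ≤ 34.9 * (R / τ) := by
  rw [Real.sqrt_le_left (by positivity)]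
  have : 0 ≤ R ^ 2 / τ ^ 2 := by positivity
  calc 3 * (405 * R ^ 2 * (1 / τ ^ 2)) = 1215 * (R ^ 2 / τ ^ 2) := by ring
    _ ≤ 34.9 ^ 2 * (R ^ 2 / τ ^ 2) := by gcongr; norm_num
    _ = (34.9 * (R / τ)) ^ 2 := by ring

/-- `η K (1 - 1/e) G = 20 R T ^ (-1/4)`. -/
theorem step_length_eq {R G τ : ℝ} (hG : 0 < G) (hτ : 0 < τ) :
    20 * R / ((1 - Real.exp (-1)) * G) * (1 / τ ^ 3) * (τ ^ 2 * ((1 - Real.exp (-1)) * G))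
      = 20 * (R / τ) := by
  have := one_sub_exp_neg_one_pos
  field_simp

theorem runSetup_of_parameters {T : ℕ} (hT : 0 < T) (hK : (K : ℝ) = Real.sqrt T)
    (hA : IsGossipMatrix Gr A) (h𝒦 : Convex ℝ 𝒦) (h0 : (0 : Vec n) ∈ 𝒦)
    (hR : ∀ x ∈ 𝒦, ‖x‖ ≤ R) (hG : 0 < G) (hlo : IsLinOpt 𝒦 lo)
    (hη : η = 20 * R / ((1 - Real.exp (-1)) * G) * (T : ℝ) ^ (-(3 / 4) : ℝ))
    (hε : ε = 405 * R ^ 2 * (T : ℝ) ^ (-(1 / 2) : ℝ))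
    (hz : ∀ t < T, ∀ i, z t i ∈ Set.Icc (0 : ℝ) 1)
    (hsg : ∀ t < T, ∀ i, ∀ x ∈ 𝒦, ∀ s, ‖sg t i x s‖ ≤ G) :
    RunSetup Gr A 𝒦 lo R G ε η K K sg z := by
  have hR0 : 0 ≤ R := by simpa using hR 0 h0
  have hE := one_sub_exp_neg_one_pos
  have hTK := eq_sq_of_sqrt hK
  obtain ⟨τ, hτ, e1, e2, e3, e4, e5⟩ := exists_fourth_root hT hK
  rw [e4] at hη
  rw [e5] at hε
  have hσ : Real.sqrt (3 * ε) ≤ 34.9 * (R / τ) := by rw [hε]; exact sqrt_tolerance_le hR0 hτ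
  have hδ : η * (K * ((1 - Real.exp (-1)) * G)) = 20 * (R / τ) := by
    rw [hη, e1]; exact step_length_eq hG hτ
  have hρ : 0 ≤ R / τ := by positivity
  have hsq : (Real.sqrt (3 * ε) + η * (K * ((1 - Real.exp (-1)) * G))) ^ 2
      ≤ 3240 * (R / τ) ^ 2 := by
    rw [hδ]
    calc (Real.sqrt (3 * ε) + 20 * (R / τ)) ^ 2 ≤ (34.9 * (R / τ) + 20 * (R / τ)) ^ 2 := by gcongr
      _ ≤ _ := by nlinarith [sq_nonneg (R / τ)]
  have hKpos : 0 < K := Nat.pos_of_ne_zero fun h => by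
    subst h; omega
  have hερ : ε = 405 * (R / τ) ^ 2 := by rw [hε]; ring
  refine ⟨hA, h𝒦, h0, hR, hlo, by rw [hερ]; positivity, by rw [hη]; positivity, ?_, ?_, hKpos,
    ?_, fun t ht => hz t (by omega), fun t ht => hsg t (by omega)⟩
  · rw [hερ] at hsq ⊢; linarith
  · intro h
    refine hsq.trans ?_
    rw [hερ, h]; simp
  · rcases hR0.eq_or_lt with h | h
    · right
      rw [hερ, ← h]; simp
    · exact cost_condition hKpos h (by rw [hε, e1]; ring)

/-- Sum over rounds, arranged in blocks. -/
theorem sum_range_mul_eq_sum_blocks (φ : ℕ → ℝ) (M K : ℕ) :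
    ∑ t ∈ Finset.range (M * K), φ t
      = ∑ m ∈ Finset.range M, ∑ t ∈ Finset.Ico (m * K) ((m + 1) * K), φ t := by
  induction M with
  | zero => simp
  | succ M ih =>
    rw [Finset.sum_range_succ, ← ih, Finset.range_eq_Ico, Finset.range_eq_Ico,
      Finset.sum_Ico_consecutive _ (Nat.zero_le _) (Nat.mul_le_mul_right K (Nat.le_succ M))]

theorem div_eq_of_mem_block {m t : ℕ} (ht : t ∈ Finset.Ico (m * K) ((m + 1) * K)) : t / K = m := by
  rw [Finset.mem_Ico] at ht
  exact Nat.div_eq_of_lt_le ht.1 ht.2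

/-- Pathwise regret of node `i` for the boosted stochastic gradients of all nodes. -/
theorem sum_inner_boostedGrad_le {T : ℕ} (hT : 0 < T) (hK : (K : ℝ) = Real.sqrt T)
    (hA : IsGossipMatrix Gr A) (h𝒦 : Convex ℝ 𝒦) (h0 : (0 : Vec n) ∈ 𝒦)
    (hR : ∀ x ∈ 𝒦, ‖x‖ ≤ R) (hG : 0 < G) (hlo : IsLinOpt 𝒦 lo)
    (hη : η = 20 * R / ((1 - Real.exp (-1)) * G) * (T : ℝ) ^ (-(3 / 4) : ℝ))
    (hε : ε = 405 * R ^ 2 * (T : ℝ) ^ (-(1 / 2) : ℝ))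
    (hz : ∀ t < T, ∀ i, z t i ∈ Set.Icc (0 : ℝ) 1)
    (hsg : ∀ t < T, ∀ i, ∀ x ∈ 𝒦, ∀ s, ‖sg t i x s‖ ≤ G)
    (hβ1 : secondEigMagnitude hA.isHermitian < 1) {u : Vec n} (hu : u ∈ 𝒦) (i : Fin N) :
    ∑ t ∈ Finset.range T, ∑ j,
        ⟪u - (dpobga lo R ε η K Gr A sg z ξ (t / K) i).x,
          boostedGrad sg z ξ t j (dpobga lo R ε η K Gr A sg z ξ (t / K) j).x⟫
      ≤ N * ((115 + (Real.sqrt N + 1) * (130 / (1 - secondEigMagnitude hA.isHermitian)))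
        * (1 - Real.exp (-1)) * R * G * (T : ℝ) ^ (3 / 4 : ℝ)) := by
  have hS := runSetup_of_parameters (sg := sg) (z := z) hT hK hA h𝒦 h0 hR hG hlo hη hε hz hsg
  have hN : 0 < N := i.pos
  have hR0 : 0 ≤ R := by simpa using hR 0 h0
  have hE := one_sub_exp_neg_one_pos
  have hTK := eq_sq_of_sqrt hK
  have hreg := (hS.gossipAscent (ξ := ξ)).sum_inner_le hA h𝒦 hN (Real.sqrt_nonneg _)
    (by have := hS.eta_nonneg; positivity) hβ1 hu i
  obtain ⟨τ, hτ, e1, e2, e3, e4, e5⟩ := exists_fourth_root hT hK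
  rw [e4] at hη
  rw [e5] at hε
  set β := secondEigMagnitude hA.isHermitian
  set G₁ := (1 - Real.exp (-1)) * G with hG₁
  have hG₁0 : 0 < G₁ := mul_pos hE hG
  set run := dpobga lo R ε η K Gr A sg z ξ with hrun
  have hblocks : ∑ t ∈ Finset.range T, ∑ j,
        ⟪u - (run (t / K) i).x, boostedGrad sg z ξ t j (run (t / K) j).x⟫
      = ∑ m ∈ Finset.range K, ∑ j, ⟪blockGrad sg z ξ K m j (run m j).x, u - (run m i).x⟫ := by
    rw [hTK, sum_range_mul_eq_sum_blocks]
    refine Finset.sum_congr rfl fun m _ => ?_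
    rw [Finset.sum_comm]
    refine Finset.sum_congr rfl fun j _ => ?_
    rw [blockGrad, sum_inner]
    refine Finset.sum_congr rfl fun t ht => ?_
    rw [div_eq_of_mem_block ht, real_inner_comm]
  rw [hblocks, e3]
  rcases hR0.eq_or_lt with hR1 | hR1
  · -- the decision set is reduced to the origin
    have hzero : ∀ x ∈ 𝒦, x = 0 := fun x hx => norm_le_zero_iff.1 (hR1 ▸ hR x hx)
    have : ∀ m ∈ Finset.range K, ∑ j, ⟪blockGrad sg z ξ K m j (run m j).x, u - (run m i).x⟫ = 0 := by
      intro m hm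
      rw [hzero u hu, hzero _ ((hS.inv m (Finset.mem_range.1 hm).le).mem i)]
      simp
    rw [Finset.sum_eq_zero this, ← hR1]
    simp
  have hσ : Real.sqrt (3 * ε) ≤ 34.9 * (R / τ) := by rw [hε]; exact sqrt_tolerance_le hR0 hτ
  have hδ : η * (K * G₁) = 20 * (R / τ) := by rw [hη, e1]; exact step_length_eq hG hτ
  have hηpos : 0 < η := by rw [hη]; positivity
  rw [hδ, e1] at hreg
  have hpull : ∑ m ∈ Finset.range K, ∑ j, ⟪η • blockGrad sg z ξ K m j (run m j).x, u - (run m i).x⟫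
      = η * ∑ m ∈ Finset.range K, ∑ j, ⟪blockGrad sg z ξ K m j (run m j).x, u - (run m i).x⟫ := by
    simp only [Finset.mul_sum, inner_smul_left, conj_trivial]
  rw [hpull] at hreg
  have hηeq : η * (G₁ * R * τ ^ 3) = 20 * R ^ 2 := by
    rw [hη, hG₁]; field_simp
  refine le_of_mul_le_mul_left (hreg.trans ?_) hηpos
  have hB : 1 - β ≠ 0 := by linarith
  have hrhs : η * (N * ((115 + (Real.sqrt N + 1) * (130 / (1 - β))) * (1 - Real.exp (-1)) * R * G
        * τ ^ 3)) = N * (20 * R ^ 2 * (115 + (Real.sqrt N + 1) * (130 / (1 - β)))) := by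
    rw [← hηeq, hG₁]; ring
  rw [hrhs]
  refine mul_le_mul_of_nonneg_left ?_ (Nat.cast_nonneg _)
  have hβ' : 0 < 1 - β := by linarith
  have hB1 : (2 * Real.sqrt (3 * ε) + 3 * (20 * (R / τ))) / (1 - β)
      ≤ (R / τ) * (130 / (1 - β)) := by
    rw [show R / τ * (130 / (1 - β)) = R / τ * 130 / (1 - β) by ring]
    refine div_le_div_of_nonneg_right ?_ hβ'.le
    have : 0 ≤ R / τ := by positivity
    linarith
  have hu2 : ‖u‖ ^ 2 ≤ R ^ 2 := by have := hR u hu; gcongr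
  calc ‖u‖ ^ 2 / 2 + τ ^ 2 * (20 * (R / τ)) ^ 2 / 2
        + τ ^ 2 * (20 * (R / τ)) * (3 * Real.sqrt (3 * ε) + (Real.sqrt N + 1)
          * ((2 * Real.sqrt (3 * ε) + 3 * (20 * (R / τ))) / (1 - β)))
      ≤ R ^ 2 / 2 + τ ^ 2 * (20 * (R / τ)) ^ 2 / 2
        + τ ^ 2 * (20 * (R / τ)) * (3 * (34.9 * (R / τ)) + (Real.sqrt N + 1)
          * ((R / τ) * (130 / (1 - β)))) := by gcongr
    _ = 20 * R ^ 2 * (10.025 + 104.7 + (Real.sqrt N + 1) * (130 / (1 - β))) := by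
        field_simp; ring
    _ ≤ _ := by
        gcongr
        norm_num

/-- Average distance of the decision of node `i` to the decisions of the other nodes. -/
theorem sum_norm_sub_run_le {T : ℕ} (hT : 0 < T) (hK : (K : ℝ) = Real.sqrt T)
    (hA : IsGossipMatrix Gr A) (h𝒦 : Convex ℝ 𝒦) (h0 : (0 : Vec n) ∈ 𝒦)
    (hR : ∀ x ∈ 𝒦, ‖x‖ ≤ R) (hG : 0 < G) (hlo : IsLinOpt 𝒦 lo)
    (hη : η = 20 * R / ((1 - Real.exp (-1)) * G) * (T : ℝ) ^ (-(3 / 4) : ℝ))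
    (hε : ε = 405 * R ^ 2 * (T : ℝ) ^ (-(1 / 2) : ℝ))
    (hz : ∀ t < T, ∀ i, z t i ∈ Set.Icc (0 : ℝ) 1)
    (hsg : ∀ t < T, ∀ i, ∀ x ∈ 𝒦, ∀ s, ‖sg t i x s‖ ≤ G)
    (hβ1 : secondEigMagnitude hA.isHermitian < 1) (i : Fin N) :
    ∑ t ∈ Finset.range T, ∑ j,
        ‖(dpobga lo R ε η K Gr A sg z ξ (t / K) i).x
          - (dpobga lo R ε η K Gr A sg z ξ (t / K) j).x‖
      ≤ N * ((70 + (Real.sqrt N + 1) * (130 / (1 - secondEigMagnitude hA.isHermitian)))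
        * R * (T : ℝ) ^ (3 / 4 : ℝ)) := by
  have hS := runSetup_of_parameters (sg := sg) (z := z) hT hK hA h𝒦 h0 hR hG hlo hη hε hz hsg
  have hN : 0 < N := i.pos
  have hR0 : 0 ≤ R := by simpa using hR 0 h0
  have hTK := eq_sq_of_sqrt hK
  have hδ0 : 0 ≤ η * (K * ((1 - Real.exp (-1)) * G)) := by
    have := hS.eta_nonneg
    have := one_sub_exp_neg_one_pos
    positivity
  have hdis := fun m (hm : m ≤ K) => (hS.gossipAscent (ξ := ξ)).sum_norm_sub_le hA h𝒦 hN
    (Real.sqrt_nonneg _) hδ0 hβ1 hm i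
  obtain ⟨τ, hτ, e1, e2, e3, e4, e5⟩ := exists_fourth_root hT hK
  rw [e4] at hη
  rw [e5] at hε
  set β := secondEigMagnitude hA.isHermitian
  have hσ : Real.sqrt (3 * ε) ≤ 34.9 * (R / τ) := by rw [hε]; exact sqrt_tolerance_le hR0 hτ
  have hδ : η * (K * ((1 - Real.exp (-1)) * G)) = 20 * (R / τ) := by
    rw [hη, e1]; exact step_length_eq hG hτ
  rw [hδ] at hdis
  have hβ' : 0 < 1 - β := by linarith
  have hρ : 0 ≤ R / τ := by positivity
  have hB1 : (2 * Real.sqrt (3 * ε) + 3 * (20 * (R / τ))) / (1 - β)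
      ≤ (R / τ) * (130 / (1 - β)) := by
    rw [show R / τ * (130 / (1 - β)) = R / τ * 130 / (1 - β) by ring]
    exact div_le_div_of_nonneg_right (by linarith) hβ'.le
  have hround : ∀ t ∈ Finset.range T, ∑ j,
        ‖(dpobga lo R ε η K Gr A sg z ξ (t / K) i).x
          - (dpobga lo R ε η K Gr A sg z ξ (t / K) j).x‖
      ≤ N * ((70 + (Real.sqrt N + 1) * (130 / (1 - β))) * (R / τ)) := by
    intro t ht
    have htK : t / K ≤ K := Nat.div_le_of_le_mul (by rw [← hTK]; exact (Finset.mem_range.1 ht).le)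
    refine le_trans (le_of_eq (Finset.sum_congr rfl fun j _ => norm_sub_rev _ _))
      ((hdis _ htK).trans ?_)
    refine mul_le_mul_of_nonneg_left ?_ (Nat.cast_nonneg _)
    calc _ ≤ 2 * (34.9 * (R / τ)) + (Real.sqrt N + 1) * ((R / τ) * (130 / (1 - β))) := by gcongr
      _ ≤ _ := by nlinarith
  refine (Finset.sum_le_sum hround).trans (le_of_eq ?_)
  rw [Finset.sum_const, Finset.card_range, nsmul_eq_mul, e3, e2]
  field_simp

end

/-! ### Measurability of the algorithm -/

/-- An observable of the final state of a loop is measurable in the parameters, if it is so after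
every number of steps. If the loop never stops, `loopResult` is the initial state. -/
theorem measurable_loopResult {β α γ : Type*} [MeasurableSpace β] [MeasurableSpace γ]
    {P : β → α → Prop} {step : β → α → α} {s : β → α} (obs : α → γ)
    (hP : ∀ k, MeasurableSet {b | P b ((step b)^[k] (s b))})
    (hobs : ∀ k, Measurable fun b => obs ((step b)^[k] (s b))) :
    Measurable fun b => obs (loopResult (P b) (step b) (s b)) := by
  classical
  set Q : ℕ → β → Prop := fun k b =>
    P b ((step b)^[k] (s b)) ∨ ¬ ∃ j, P b ((step b)^[j] (s b)) with hQ
  have hQex : ∀ b, ∃ k, Q k b := by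
    intro b
    by_cases h : ∃ j, P b ((step b)^[j] (s b))
    · obtain ⟨j, hj⟩ := h
      exact ⟨j, Or.inl hj⟩
    · exact ⟨0, Or.inr h⟩
  have hQm : ∀ k, MeasurableSet {b | Q k b} := by
    intro k
    refine (hP k).union ?_
    have : {b | ¬ ∃ j, P b ((step b)^[j] (s b))} = (⋃ j, {b | P b ((step b)^[j] (s b))})ᶜ := by
      ext b; simp
    change MeasurableSet {b | ¬ ∃ j, P b ((step b)^[j] (s b))}
    rw [this]
    exact (MeasurableSet.iUnion hP).compl
  have key := Measurable.find (f := fun k b => obs ((step b)^[k] (s b))) (p := Q) hobs hQm hQex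
  have e : ∀ b, loopResult (P b) (step b) (s b) = (step b)^[Nat.find (hQex b)] (s b) := by
    intro b
    unfold loopResult loopCount
    by_cases h : ∃ j, P b ((step b)^[j] (s b))
    · have hfind : Nat.find (hQex b) = Nat.find h :=
        le_antisymm (Nat.find_min' _ (Or.inl (Nat.find_spec h)))
          (Nat.find_min' _ ((Nat.find_spec (hQex b)).resolve_right (not_not.2 h)))
      rw [dif_pos h, ENat.toNat_natCast, hfind]
    · rw [dif_neg h, ENat.toNat_top, (Nat.find_eq_zero (hQex b)).2 (Or.inr h)]
  simp only [e]
  exact key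

section
variable {n : ℕ} {lo : Vec n → Vec n}

theorem measurable_lineSearch {β : Type*} [MeasurableSpace β] {y x v : β → Vec n}
    (hy : Measurable y) (hx : Measurable x) (hv : Measurable v) :
    Measurable fun b => lineSearch (y b) (x b) (v b) := by
  unfold lineSearch
  have h1 : Measurable fun b => ⟪y b - x b, v b - x b⟫ := (hy.sub hx).inner (hv.sub hx)
  have h2 : Measurable fun b => ‖v b - x b‖ ^ 2 := (hv.sub hx).norm.pow_const 2
  exact measurable_const.max (measurable_const.min (h1.div h2))

theorem measurable_shfwStep {β : Type*} [MeasurableSpace β] (hlo : Measurable lo)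
    {y x : β → Vec n} (hy : Measurable y) (hx : Measurable x) :
    Measurable fun b => shfwStep lo (y b) (x b) := by
  unfold shfwStep
  have h1 : Measurable fun b => lo (x b - y b) := hlo.comp (hx.sub hy)
  exact hx.add ((measurable_lineSearch hy hx h1).smul (h1.sub hx))

theorem measurable_shfw {β : Type*} [MeasurableSpace β] (hlo : Measurable lo) (ε : ℝ)
    {x y : β → Vec n} (hx : Measurable x) (hy : Measurable y) :
    Measurable fun b => shfw lo (x b) (y b) ε := by
  have hit : ∀ k, Measurable fun b => (shfwStep lo (y b))^[k] (x b) := by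
    intro k
    induction k with
    | zero => exact hx
    | succ k ih =>
      simp only [Function.iterate_succ_apply']
      exact measurable_shfwStep hlo hy ih
  refine measurable_loopResult (P := fun b => shfwStop lo (y b) ε)
    (step := fun b => shfwStep lo (y b)) (s := x) id (fun k => ?_) hit
  have h1 := (hit k).sub hy
  have h2 : Measurable fun b => ⟪(shfwStep lo (y b))^[k] (x b) - y b,
      (shfwStep lo (y b))^[k] (x b) - lo ((shfwStep lo (y b))^[k] (x b) - y b)⟫ :=
    h1.inner ((hit k).sub (hlo.comp h1))
  exact (measurableSet_le h2 measurable_const).union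
    (measurableSet_le (h1.norm.pow_const 2) measurable_const)

theorem measurable_infeasibleProj {β : Type*} [MeasurableSpace β] (hlo : Measurable lo)
    (R ε : ℝ) {x₀ y₀ : β → Vec n} (hx : Measurable x₀) (hy : Measurable y₀) :
    (Measurable fun b => (infeasibleProj lo R (x₀ b) (y₀ b) ε).x) ∧
      Measurable fun b => (infeasibleProj lo R (x₀ b) (y₀ b) ε).yt := by
  set y₁ : β → Vec n := fun b => (max 1 (‖y₀ b‖ / R))⁻¹ • y₀ b with hy₁
  have hy₁m : Measurable y₁ := (measurable_const.max (hy.norm.div_const R)).inv.smul hy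
  set γ : β → ℝ := fun b => 2 * ε / ‖x₀ b - y₀ b‖ ^ 2 with hγ
  have hγm : Measurable γ := measurable_const.div ((hx.sub hy).norm.pow_const 2)
  set s₁ : β → IPState n := fun b =>
    ⟨shfw lo (x₀ b) (y₁ b) ε, y₁ b, shfwCost lo (x₀ b) (y₁ b) ε⟩ with hs₁
  have hit : ∀ k, (Measurable fun b => ((ipStep lo ε (γ b))^[k] (s₁ b)).x) ∧
      Measurable fun b => ((ipStep lo ε (γ b))^[k] (s₁ b)).yt := by
    intro k
    induction k with
    | zero => exact ⟨measurable_shfw hlo ε hx hy₁m, hy₁m⟩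
    | succ k ih =>
      simp only [Function.iterate_succ_apply']
      have h1 := ih.2.sub (hγm.smul (ih.2.sub ih.1))
      exact ⟨measurable_shfw hlo ε ih.1 h1, h1⟩
  have hP : ∀ k, MeasurableSet {b | ipStop ε ((ipStep lo ε (γ b))^[k] (s₁ b))} := fun k =>
    measurableSet_le (((hit k).1.sub (hit k).2).norm.pow_const 2) measurable_const
  have hcase : MeasurableSet {b | ‖x₀ b - y₀ b‖ ^ 2 ≤ 3 * ε} :=
    measurableSet_le ((hx.sub hy).norm.pow_const 2) measurable_const
  have hl := fun (obs : IPState n → Vec n) => measurable_loopResult (P := fun _ => ipStop ε)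
    (step := fun b => ipStep lo ε (γ b)) (s := s₁) obs hP
  have e : ∀ b, (infeasibleProj lo R (x₀ b) (y₀ b) ε).x
        = (if ‖x₀ b - y₀ b‖ ^ 2 ≤ 3 * ε then x₀ b
          else (loopResult (ipStop ε) (ipStep lo ε (γ b)) (s₁ b)).x) ∧
      (infeasibleProj lo R (x₀ b) (y₀ b) ε).yt
        = (if ‖x₀ b - y₀ b‖ ^ 2 ≤ 3 * ε then y₁ b
          else (loopResult (ipStop ε) (ipStep lo ε (γ b)) (s₁ b)).yt) := by
    intro b
    unfold infeasibleProj
    by_cases h : ‖x₀ b - y₀ b‖ ^ 2 ≤ 3 * ε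
    · rw [if_pos h, if_pos h, if_pos h]
      exact ⟨rfl, rfl⟩
    · rw [if_neg h, if_neg h, if_neg h]
      dsimp only
      split_ifs <;> exact ⟨rfl, rfl⟩
  simp only [fun b => (e b).1, fun b => (e b).2]
  exact ⟨Measurable.ite hcase hx (hl _ fun k => (hit k).1),
    Measurable.ite hcase hy₁m (hl _ fun k => (hit k).2)⟩

variable {N : ℕ} {Gr : SimpleGraph (Fin N)} {A : Matrix (Fin N) (Fin N) ℝ} {R ε η : ℝ} {K : ℕ}
  {Ω Ξ : Type*} [MeasurableSpace Ξ] {sg : ℕ → Fin N → Vec n → Ξ → Vec n}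

theorem measurable_mix {β : Type*} [MeasurableSpace β] (A : Matrix (Fin N) (Fin N) ℝ)
    {w : β → Fin N → Vec n} (hw : ∀ j, Measurable fun b => w b j) (i : Fin N) :
    Measurable fun b => mix A (w b) i := by
  unfold mix
  exact Finset.measurable_sum _ fun j _ => (hw j).const_smul (A i j)

theorem measurable_stochGrad {β : Type*} [MeasurableSpace β] {t : ℕ} {i : Fin N}
    (hsg : Measurable (Function.uncurry (sg t i))) {z : β → ℝ} {x : β → Vec n} {ξ : β → Ξ}
    (hz : Measurable z) (hx : Measurable x) (hξ : Measurable ξ) :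
    Measurable fun b => sg t i (z b • x b) (ξ b) :=
  hsg.comp ((hz.smul hx).prodMk hξ)

/-- The state after `m` blocks is a measurable function of the randomness of the rounds before
`m K`. -/
theorem measurable_dpobga [MeasurableSpace Ω] (hA : IsGossipMatrix Gr A) (hlo : Measurable lo)
    {z : ℕ → Fin N → Ω → ℝ} {ξ : ℕ → Fin N → Ω → Ξ} (m : ℕ)
    (hsg : ∀ t < m * K, ∀ i, Measurable (Function.uncurry (sg t i)))
    (hz : ∀ t < m * K, ∀ i, Measurable (z t i))
    (hξ : ∀ t < m * K, ∀ i, Measurable (ξ t i)) (i : Fin N) :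
    (Measurable fun ω =>
        (dpobga lo R ε η K Gr A sg (fun t i => z t i ω) (fun t i => ξ t i ω) m i).x) ∧
      Measurable fun ω =>
        (dpobga lo R ε η K Gr A sg (fun t i => z t i ω) (fun t i => ξ t i ω) m i).yt := by
  induction m generalizing i with
  | zero => exact ⟨measurable_const, measurable_const⟩
  | succ m ih =>
    have hle : m * K ≤ (m + 1) * K := Nat.mul_le_mul_right K (Nat.le_succ m)
    have ih' := ih (fun t ht => hsg t (ht.trans_le hle)) (fun t ht => hz t (ht.trans_le hle))
      (fun t ht => hξ t (ht.trans_le hle))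
    simp only [hA.dpobga_succ]
    refine measurable_infeasibleProj hlo R ε (measurable_mix A (fun j => (ih' j).1) i)
      ((measurable_mix A (fun j => (ih' j).2) i).add (Measurable.const_smul
        (Finset.measurable_sum _ fun t ht => ?_) η))
    have ht' := (Finset.mem_Ico.1 ht).2
    exact (measurable_stochGrad (hsg t ht' i) (hz t ht' i) (ih' i).1 (hξ t ht' i)).const_smul
      (1 - Real.exp (-1))

end

/-! ### Expected progress in one round -/

section
variable {n : ℕ} {I : Fin n → Set ℝ} {f : Vec n → ℝ} {gradf : Vec n → Vec n} {𝒦 X : Set (Vec n)}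
  {R L : ℝ}

theorem IsLSmoothOn.norm_gradient_le (hs : IsLSmoothOn L f gradf 𝒦 X) (h0 : (0 : Vec n) ∈ 𝒦)
    (hR : ∀ x ∈ 𝒦, ‖x‖ ≤ R) (hL : 0 ≤ L) {x : Vec n} (hx : x ∈ 𝒦) :
    ‖gradf x‖ ≤ ‖gradf 0‖ + L * R := by
  have h1 := hs.lipschitz x hx 0 h0
  rw [sub_zero] at h1
  have h2 : L * ‖x‖ ≤ L * R := mul_le_mul_of_nonneg_left (hR x hx) hL
  have h3 := norm_le_norm_add_norm_sub' (gradf x) (gradf 0)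
  linarith

theorem IsLSmoothOn.exists_continuous_gradient (hs : IsLSmoothOn L f gradf 𝒦 X) (hL : 0 ≤ L) :
    ∃ g : Vec n → Vec n, Continuous g ∧ ∀ x ∈ 𝒦, g x = gradf x := by
  have h : LipschitzOnWith ⟨L, hL⟩ gradf 𝒦 :=
    LipschitzOnWith.of_dist_le_mul fun x hx y hy => by
      rw [dist_eq_norm, dist_eq_norm]; exact hs.lipschitz x hx y hy
  obtain ⟨g, hg, he⟩ := h.extend_finite_dimension
  exact ⟨g, hg.continuous, fun x hx => (he hx).symm⟩

theorem IsLSmoothOn.lipschitzOnWith (hs : IsLSmoothOn L f gradf 𝒦 X) (h𝒦X : 𝒦 ⊆ X)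
    (h𝒦 : Convex ℝ 𝒦) (h0 : (0 : Vec n) ∈ 𝒦) (hR : ∀ x ∈ 𝒦, ‖x‖ ≤ R) (hL : 0 ≤ L) :
    LipschitzOnWith (‖gradf 0‖ + L * R).toNNReal f 𝒦 := by
  refine Convex.lipschitzOnWith_of_nnnorm_hasFDerivWithin_le (𝕜 := ℝ)
    (fun x hx => (hs.hasGradient x hx).hasFDerivWithinAt.mono h𝒦X) (fun x hx => ?_) h𝒦
  rw [← NNReal.coe_le_coe, coe_nnnorm, LinearIsometryEquiv.norm_map]
  exact (hs.norm_gradient_le h0 hR hL hx).trans (Real.le_coe_toNNReal _)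

variable {Ω : Type*} {m : MeasurableSpace Ω} [mΩ : MeasurableSpace Ω] {μ : Measure Ω} [IsProbabilityMeasure μ]

theorem integrable_of_bound {E : Type*} [NormedAddCommGroup E] [MeasurableSpace E] [BorelSpace E]
    [SecondCountableTopology E] {φ : Ω → E} (hφ : Measurable φ) {C : ℝ} (hC : ∀ ω, ‖φ ω‖ ≤ C) :
    Integrable φ μ :=
  Integrable.of_bound hφ.aestronglyMeasurable C (Filter.Eventually.of_forall hC)

/-- `𝒦` need not be measurable: `f` is replaced by a Lipschitz extension. -/
theorem IsLSmoothOn.integrable_comp (hs : IsLSmoothOn L f gradf 𝒦 X) (h𝒦X : 𝒦 ⊆ X)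
    (h𝒦 : Convex ℝ 𝒦) (h0 : (0 : Vec n) ∈ 𝒦) (hR : ∀ x ∈ 𝒦, ‖x‖ ≤ R) (hL : 0 ≤ L)
    {x : Ω → Vec n} (hx : Measurable x) (hx𝒦 : ∀ ω, x ω ∈ 𝒦) :
    Integrable (fun ω => f (x ω)) μ := by
  have hlip := hs.lipschitzOnWith h𝒦X h𝒦 h0 hR hL
  obtain ⟨g, hg, he⟩ := hlip.extend_real
  have e : (fun ω => f (x ω)) = fun ω => g (x ω) := funext fun ω => he (hx𝒦 ω)
  set C := (‖gradf 0‖ + L * R).toNNReal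
  refine integrable_of_bound (C := |f 0| + C * R) ?_ fun ω => ?_
  · rw [e]; exact hg.continuous.measurable.comp hx
  · have h1 := hlip.dist_le_mul _ (hx𝒦 ω) 0 h0
    rw [Real.dist_eq, dist_zero_right] at h1
    have h2 : (C : ℝ) * ‖x ω‖ ≤ C * R := mul_le_mul_of_nonneg_left (hR _ (hx𝒦 ω)) C.2
    rw [Real.norm_eq_abs]
    have h3 := abs_sub_abs_le_abs_sub (f (x ω)) (f 0)
    linarith

/-- Averaging over a scaling `Z` that is independent of the past: if `x`, `y` are determined by the
past `m`, then `⟪u - x, ∇f (Z y)⟫` has the same mean as its average over the law of `Z`. -/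
theorem integral_inner_gradient_eq (hm : m ≤ mΩ)
    (hs : IsLSmoothOn L f gradf 𝒦 X) (h𝒦 : Convex ℝ 𝒦) (h0 : (0 : Vec n) ∈ 𝒦)
    (hR : ∀ x ∈ 𝒦, ‖x‖ ≤ R) (hL : 0 ≤ L) {Z : Ω → ℝ} (hZ : Measurable Z)
    (hZ01 : ∀ ω, Z ω ∈ Set.Icc (0 : ℝ) 1) (hlaw : μ.map Z = boostLaw)
    (hind : Indep (MeasurableSpace.comap Z inferInstance) m μ) {x y : Ω → Vec n}
    (hx : Measurable[m] x) (hy : Measurable[m] y) (hx𝒦 : ∀ ω, x ω ∈ 𝒦) (hy𝒦 : ∀ ω, y ω ∈ 𝒦)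
    {u : Vec n} (hu : u ∈ 𝒦) :
    Integrable (fun ω => ∫ s, ⟪u - x ω, gradf (s • y ω)⟫ ∂boostLaw) μ ∧
      ∫ ω, ⟪u - x ω, gradf (Z ω • y ω)⟫ ∂μ
        = ∫ ω, (∫ s, ⟪u - x ω, gradf (s • y ω)⟫ ∂boostLaw) ∂μ := by
  obtain ⟨g, hg, hge⟩ := hs.exists_continuous_gradient hL
  have hprob : IsProbabilityMeasure boostLaw := by
    rw [← hlaw]; exact Measure.isProbabilityMeasure_map hZ.aemeasurable
  have hray : ∀ p ∈ 𝒦, ∀ s ∈ Set.Icc (0 : ℝ) 1, s • p ∈ 𝒦 := fun p hp s hs =>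
    h𝒦.smul_mem_of_zero_mem h0 hp hs
  have hxm := hx.mono hm le_rfl
  have hym := hy.mono hm le_rfl
  set W : Ω → Vec n × Vec n := fun ω => (x ω, y ω) with hW
  have hWm : Measurable[m] W := Measurable.prodMk hx hy
  have hWm' : Measurable W := hWm.mono hm le_rfl
  set h : ℝ × (Vec n × Vec n) → ℝ := fun p => ⟪u - p.2.1, g (p.1 • p.2.2)⟫ with hh
  have hcont : Continuous h := by
    simp only [hh]
    fun_prop
  have hindep : IndepFun Z W μ := by
    rw [IndepFun_iff_Indep]
    exact indep_of_indep_of_le_right hind hWm.comap_le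
  have hjoint : μ.map (fun ω => (Z ω, W ω)) = boostLaw.prod (μ.map W) := by
    rw [← hlaw]
    exact (indepFun_iff_map_prod_eq_prod_map_map hZ.aemeasurable hWm'.aemeasurable).1 hindep
  have hint : Integrable (fun ω => h (Z ω, W ω)) μ := by
    refine integrable_of_bound (C := (R + R) * (‖gradf 0‖ + L * R))
      (hcont.measurable.comp (hZ.prodMk hWm')) fun ω => ?_
    have h1 : Z ω • y ω ∈ 𝒦 := hray _ (hy𝒦 ω) _ (hZ01 ω)
    simp only [hh, hW, hge _ h1]
    refine (norm_inner_le_norm _ _).trans ?_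
    refine mul_le_mul ?_ (hs.norm_gradient_le h0 hR hL h1) (norm_nonneg _) ?_
    · exact (norm_sub_le _ _).trans (add_le_add (hR _ hu) (hR _ (hx𝒦 ω)))
    · linarith [(norm_nonneg _).trans (hR _ hu)]
  have hint2 : Integrable h (boostLaw.prod (μ.map W)) := by
    rw [← hjoint]
    exact (integrable_map_measure hcont.aestronglyMeasurable
      (hZ.prodMk hWm').aemeasurable).2 hint
  have hsm : AEStronglyMeasurable (fun w => ∫ s, h (s, w) ∂boostLaw) (μ.map W) :=
    hint2.integral_prod_right.aestronglyMeasurable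
  have einner : ∀ ω, ∫ s, h (s, W ω) ∂boostLaw = ∫ s, ⟪u - x ω, gradf (s • y ω)⟫ ∂boostLaw := by
    intro ω
    refine mul_left_cancel₀ one_sub_exp_neg_one_pos.ne' ?_
    rw [integral_boostLaw, integral_boostLaw]
    refine intervalIntegral.integral_congr fun s hs' => ?_
    rw [Set.uIcc_of_le zero_le_one] at hs'
    simp only [hh, hW, hge _ (hray _ (hy𝒦 ω) s hs')]
  constructor
  · have := (integrable_map_measure hsm hWm'.aemeasurable).1 hint2.integral_prod_right
    refine this.congr (Filter.Eventually.of_forall fun ω => ?_)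
    exact einner ω
  · calc ∫ ω, ⟪u - x ω, gradf (Z ω • y ω)⟫ ∂μ = ∫ ω, h (Z ω, W ω) ∂μ := by
          refine integral_congr_ae (Filter.Eventually.of_forall fun ω => ?_)
          simp only [hh, hW, hge _ (hray _ (hy𝒦 ω) _ (hZ01 ω))]
      _ = ∫ p, h p ∂(μ.map fun ω => (Z ω, W ω)) :=
          (integral_map (hZ.prodMk hWm').aemeasurable hcont.aestronglyMeasurable).symm
      _ = ∫ w, ∫ s, h (s, w) ∂boostLaw ∂(μ.map W) := by
          rw [hjoint]; exact integral_prod_symm _ hint2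
      _ = ∫ ω, ∫ s, h (s, W ω) ∂boostLaw ∂μ := integral_map hWm'.aemeasurable hsm
      _ = _ := by simp only [einner]

/-- Expected progress of one stochastic boosted gradient `(1 - 1/e) S`, taken at a scaling of `y`,
for the regret of the decision `x`. -/
theorem integral_regret_le (hm : m ≤ mΩ)
    (hI : ∀ k, IsClosedIntervalNonneg (I k)) (h𝒦X : 𝒦 ⊆ boxSet I)
    (h𝒦 : Convex ℝ 𝒦) (h0 : (0 : Vec n) ∈ 𝒦) (hR : ∀ x ∈ 𝒦, ‖x‖ ≤ R) (hL : 0 ≤ L)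
    (hs : IsLSmoothOn L f gradf 𝒦 (boxSet I)) (hmono : IsMonotoneOn f (boxSet I))
    (hf : IsDRSubmodularOn f (boxSet I)) (hf0 : f 0 = 0) {Z : Ω → ℝ} (hZ : Measurable Z)
    (hZ01 : ∀ ω, Z ω ∈ Set.Icc (0 : ℝ) 1) (hlaw : μ.map Z = boostLaw)
    (hind : Indep (MeasurableSpace.comap Z inferInstance) m μ) {x y : Ω → Vec n}
    (hx : Measurable[m] x) (hy : Measurable[m] y) (hx𝒦 : ∀ ω, x ω ∈ 𝒦) (hy𝒦 : ∀ ω, y ω ∈ 𝒦)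
    {S : Ω → Vec n} (hS : Integrable S μ)
    (hunb : μ[S | m ⊔ MeasurableSpace.comap Z inferInstance]
      =ᵐ[μ] fun ω => gradf (Z ω • y ω)) {u : Vec n} (hu : u ∈ 𝒦) :
    ∫ ω, ((1 - Real.exp (-1)) * f u - f (x ω)
        - 2 * R * L * Real.exp (-1) * ‖x ω - y ω‖) ∂μ
      ≤ ∫ ω, ⟪u - x ω, (1 - Real.exp (-1)) • S ω⟫ ∂μ := by
  have hxm := hx.mono hm le_rfl
  have hym := hy.mono hm le_rfl
  have hm' : m ⊔ MeasurableSpace.comap Z inferInstance ≤ mΩ := sup_le hm hZ.comap_le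
  have hbound : ∀ ω, ‖u - x ω‖ ≤ R + R := fun ω =>
    (norm_sub_le _ _).trans (add_le_add (hR _ hu) (hR _ (hx𝒦 ω)))
  have hxsub : Measurable[m] fun ω => u - x ω := Measurable.sub measurable_const hx
  have hpull : μ[fun ω => ⟪u - x ω, S ω⟫ | m ⊔ MeasurableSpace.comap Z inferInstance]
      =ᵐ[μ] fun ω => ⟪u - x ω, gradf (Z ω • y ω)⟫ := by
    have hsm : StronglyMeasurable[m ⊔ MeasurableSpace.comap Z inferInstance]
        fun ω => u - x ω :=
      (hxsub.mono (le_sup_left : m ≤ m ⊔ MeasurableSpace.comap Z inferInstance)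
        le_rfl).stronglyMeasurable
    have h1 := condExp_stronglyMeasurable_bilin_of_bound
      (innerSL ℝ : Vec n →L[ℝ] Vec n →L[ℝ] ℝ) hm' hsm hS (R + R)
      (Filter.Eventually.of_forall hbound)
    filter_upwards [h1, hunb] with ω h2 h3
    refine Eq.trans h2 ?_
    rw [h3]
    rfl
  obtain ⟨hint, heq⟩ := integral_inner_gradient_eq hm hs h𝒦 h0 hR hL hZ hZ01 hlaw hind hx hy
    hx𝒦 hy𝒦 hu
  have e : ∫ ω, ⟪u - x ω, (1 - Real.exp (-1)) • S ω⟫ ∂μ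
      = ∫ ω, (1 - Real.exp (-1)) * (∫ s, ⟪u - x ω, gradf (s • y ω)⟫ ∂boostLaw) ∂μ := by
    simp only [inner_smul_right]
    rw [integral_const_mul, integral_const_mul, ← heq, ← integral_condExp hm',
      integral_congr_ae hpull]
  rw [e]
  refine integral_mono ?_ (hint.const_mul _) fun ω => ?_
  · refine ((integrable_const _).sub
      (hs.integrable_comp h𝒦X h𝒦 h0 hR hL hxm hx𝒦)).sub (Integrable.const_mul ?_ _)
    refine integrable_of_bound (C := R + R) (hxm.sub hym).norm fun ω => ?_
    rw [norm_norm]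
    exact (norm_sub_le _ _).trans (add_le_add (hR _ (hx𝒦 ω)) (hR _ (hy𝒦 ω)))
  · exact boost_inequality hI h𝒦X h𝒦 h0 hR hL hs hmono hf hf0 (hx𝒦 ω) (hy𝒦 ω) hu

end

/-! ### Expected regret of the algorithm -/

theorem theorem2
    {n N T K : ℕ} (hT : 0 < T) (hK : (K : ℝ) = Real.sqrt T)
    -- the decision set, inside a product of closed intervals of the nonnegative reals
    {I : Fin n → Set ℝ} (hI : ∀ k, IsClosedIntervalNonneg (I k))
    {𝒦 : Set (Vec n)} (h𝒦X : 𝒦 ⊆ boxSet I) (h𝒦 : Convex ℝ 𝒦) (h0 : (0 : Vec n) ∈ 𝒦)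
    {R G L : ℝ} (hR : ∀ x ∈ 𝒦, ‖x‖ ≤ R) (hG : 0 < G) (hL : 0 ≤ L)
    {lo : Vec n → Vec n} (hlo : IsLinOpt 𝒦 lo) (hlo_meas : Measurable lo)
    -- the local reward functions and their gradients
    {f : ℕ → Fin N → Vec n → ℝ} {gradf : ℕ → Fin N → Vec n → Vec n}
    (hf_smooth : ∀ t < T, ∀ i, IsLSmoothOn L (f t i) (gradf t i) 𝒦 (boxSet I))
    (hf_mono : ∀ t < T, ∀ i, IsMonotoneOn (f t i) (boxSet I))
    (hf_dr : ∀ t < T, ∀ i, IsDRSubmodularOn (f t i) (boxSet I))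
    (hf_zero : ∀ t < T, ∀ i, f t i 0 = 0)
    -- the network
    {Gr : SimpleGraph (Fin N)} {A : Matrix (Fin N) (Fin N) ℝ} (hA : IsGossipMatrix Gr A)
    {β : ℝ} (hβ : β = secondEigMagnitude hA.isHermitian) (hβ1 : β < 1)
    -- the randomness; `ℱ t` is the information available before round `t`
    {Ω Ξ : Type*} [mΩ : MeasurableSpace Ω] [MeasurableSpace Ξ]
    {μ : Measure Ω} [IsProbabilityMeasure μ] {ℱ : Filtration ℕ mΩ}
    -- the samples from the law of `Z`
    {z : ℕ → Fin N → Ω → ℝ}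
    (hz_meas : ∀ t < T, ∀ i, Measurable[ℱ (t + 1)] (z t i))
    (hz_mem : ∀ t < T, ∀ i ω, z t i ω ∈ Set.Icc (0 : ℝ) 1)
    (hz_law : ∀ t < T, ∀ i, μ.map (z t i) = boostLaw)
    (hz_indep : ∀ t < T, ∀ i,
      Indep (MeasurableSpace.comap (z t i) inferInstance) (ℱ t) μ)
    -- the stochastic gradient oracles and their noise
    {sg : ℕ → Fin N → Vec n → Ξ → Vec n} {ξ : ℕ → Fin N → Ω → Ξ}
    (hsg_meas : ∀ t < T, ∀ i, Measurable (Function.uncurry (sg t i)))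
    (hξ_meas : ∀ t < T, ∀ i, Measurable[ℱ (t + 1)] (ξ t i))
    (hsg_bound : ∀ t < T, ∀ i, ∀ x ∈ 𝒦, ∀ s, ‖sg t i x s‖ ≤ G)
    -- the parameters, and the resulting run of the algorithm
    {η ε : ℝ}
    (hη : η = 20 * R / ((1 - Real.exp (-1)) * G) * (T : ℝ) ^ (-(3 / 4) : ℝ))
    (hε : ε = 405 * R ^ 2 * (T : ℝ) ^ (-(1 / 2) : ℝ))
    {run : Ω → ℕ → Fin N → NodeState n}
    (hrun : ∀ ω, run ω =
      dpobga lo R ε η K Gr A sg (fun t i => z t i ω) (fun t i => ξ t i ω))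
    -- unbiasedness at the query point, given the past and the sampled scaling
    (hsg_unbiased : ∀ t < T, ∀ i,
      μ[fun ω => sg t i (z t i ω • (run ω (t / K) i).x) (ξ t i ω) |
          ℱ t ⊔ MeasurableSpace.comap (z t i) inferInstance]
        =ᵐ[μ] fun ω => gradf t i (z t i ω • (run ω (t / K) i).x))
    (i : Fin N) :
    -- the decisions are feasible
    (∀ ω, ∀ t < T, (run ω (t / K) i).x ∈ 𝒦) ∧
    -- expected regret
    Integrable (fun ω =>
      avgRegret (1 - Real.exp (-1)) 𝒦 f T (fun t => (run ω (t / K) i).x)) μ ∧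
    ∫ ω, avgRegret (1 - Real.exp (-1)) 𝒦 f T (fun t => (run ω (t / K) i).x) ∂μ
      ≤ ((958 + 86 * (Real.sqrt N + 1))
            + 1 / (1 - β) * (842 + 130 * (Real.sqrt N + 1)))
          * (1 - Real.exp (-1)) * R * G * (T : ℝ) ^ (3 / 4 : ℝ)
        + (171 + 260 / (1 - β)) * Real.exp (-1) * (Real.sqrt N + 1) * R ^ 2 * L
          * (T : ℝ) ^ (3 / 4 : ℝ) ∧
    -- linear optimization steps in all the blocks together
    (∀ ω, (run ω (T / K) i).loSteps ≤ (T : ℕ∞)) ∧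
    -- one exchange with the neighbours per block, hence `√T` of them in total
    (∀ ω, ∀ m < T / K, (run ω (m + 1) i).comms = (run ω m i).comms + 1) ∧
    (∀ ω, ((run ω (T / K) i).comms : ℝ) = Real.sqrt T) := by
  have hR0 : 0 ≤ R := by simpa using hR 0 h0
  have hE := one_sub_exp_neg_one_pos
  have hTK := eq_sq_of_sqrt hK
  have hN : 0 < N := i.pos
  have hN' : (0 : ℝ) < N := by exact_mod_cast hN
  have hSetup : ∀ ω, RunSetup Gr A 𝒦 lo R G ε η K K sg (fun t i => z t i ω) := fun ω =>
    runSetup_of_parameters hT hK hA h𝒦 h0 hR hG hlo hη hε (fun t ht j => hz_mem t ht j ω) hsg_bound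
  have hInv : ∀ ω, ∀ m ≤ K, RunInv 𝒦 ε K m (run ω m) := fun ω m hm => by
    rw [hrun]; exact (hSetup ω).inv m hm
  have hKpos : 0 < K := Nat.pos_of_ne_zero fun h => by subst h; omega
  have hdivK : T / K = K := by rw [hTK, Nat.mul_div_cancel _ hKpos]
  have hblock : ∀ t < T, t / K ≤ K := fun t ht =>
    (Nat.div_le_div_right ht.le).trans hdivK.le
  have hmem : ∀ ω, ∀ t < T, ∀ j, (run ω (t / K) j).x ∈ 𝒦 := fun ω t ht j =>
    (hInv ω _ (hblock t ht)).mem j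
  -- the decisions of round `t` are determined by the rounds before `t`
  have hmeas : ∀ t < T, ∀ j, Measurable[ℱ t] fun ω => (run ω (t / K) j).x := by
    intro t ht j
    have hle : t / K * K ≤ t := Nat.div_mul_le_self t K
    have := (@measurable_dpobga n lo N Gr A R ε η K Ω Ξ _ sg (ℱ t) hA hlo_meas z ξ (t / K)
      (fun s hs => hsg_meas s (by omega))
      (fun s hs k => (hz_meas s (by omega) k).mono (ℱ.mono (by omega)) le_rfl)
      (fun s hs k => (hξ_meas s (by omega) k).mono (ℱ.mono (by omega)) le_rfl) j).1
    simpa only [hrun] using this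
  have hmeas' : ∀ t < T, ∀ j, Measurable fun ω => (run ω (t / K) j).x := fun t ht j =>
    (hmeas t ht j).mono (ℱ.le t) le_rfl
  have hz' : ∀ t < T, ∀ j, Measurable (z t j) := fun t ht j =>
    (hz_meas t ht j).mono (ℱ.le _) le_rfl
  have hξ' : ∀ t < T, ∀ j, Measurable (ξ t j) := fun t ht j =>
    (hξ_meas t ht j).mono (ℱ.le _) le_rfl
  have hf_int : ∀ t < T, ∀ j, Integrable (fun ω => f t j (run ω (t / K) i).x) μ := fun t ht j =>
    (hf_smooth t ht j).integrable_comp h𝒦X h𝒦 h0 hR hL (hmeas' t ht i) (fun ω => hmem ω t ht i)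
  have hS_meas : ∀ t < T, ∀ j,
      Measurable fun ω => sg t j (z t j ω • (run ω (t / K) j).x) (ξ t j ω) := fun t ht j =>
    measurable_stochGrad (hsg_meas t ht j) (hz' t ht j) (hmeas' t ht j) (hξ' t ht j)
  have hS_bound : ∀ t < T, ∀ j ω, ‖sg t j (z t j ω • (run ω (t / K) j).x) (ξ t j ω)‖ ≤ G :=
    fun t ht j ω => hsg_bound t ht j _
      (h𝒦.smul_mem_of_zero_mem h0 (hmem ω t ht j) (hz_mem t ht j ω)) _
  have hS_int : ∀ t < T, ∀ j,
      Integrable (fun ω => sg t j (z t j ω • (run ω (t / K) j).x) (ξ t j ω)) μ := fun t ht j =>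
    integrable_of_bound (hS_meas t ht j) (hS_bound t ht j)
  have hd_int : ∀ t < T, ∀ j,
      Integrable (fun ω => ‖(run ω (t / K) i).x - (run ω (t / K) j).x‖) μ := fun t ht j =>
    integrable_of_bound (C := R + R) ((hmeas' t ht i).sub (hmeas' t ht j)).norm fun ω => by
      rw [norm_norm]
      exact (norm_sub_le _ _).trans
        (add_le_add (hR _ (hmem ω t ht i)) (hR _ (hmem ω t ht j)))
  set α := 1 - Real.exp (-1) with hα
  set C := 2 * R * L * Real.exp (-1) with hC
  have hC0 : 0 ≤ C := by positivity
  set τ₃ := (T : ℝ) ^ (3 / 4 : ℝ) with hτ₃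
  have hτ₃0 : 0 ≤ τ₃ := by positivity
  rw [hβ] at hβ1
  set D := 130 / (1 - β) with hD
  -- regret against a fixed comparator
  have hfixed : ∀ u ∈ 𝒦, ∑ t ∈ Finset.range T, ∑ j,
      (α * f t j u - ∫ ω, f t j (run ω (t / K) i).x ∂μ)
        ≤ N * ((115 + (Real.sqrt N + 1) * D) * α * R * G * τ₃)
          + C * (N * ((70 + (Real.sqrt N + 1) * D) * R * τ₃)) := by
    intro u hu
    have hin_int : ∀ t < T, ∀ j, Integrable (fun ω => ⟪u - (run ω (t / K) i).x,
        α • sg t j (z t j ω • (run ω (t / K) j).x) (ξ t j ω)⟫) μ := by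
      intro t ht j
      have hm1 : Measurable fun ω => ⟪u - (run ω (t / K) i).x,
          α • sg t j (z t j ω • (run ω (t / K) j).x) (ξ t j ω)⟫ :=
        (measurable_const.sub (hmeas' t ht i)).inner ((hS_meas t ht j).const_smul α)
      refine integrable_of_bound (C := (R + R) * (α * G)) hm1 fun ω => ?_
      refine (norm_inner_le_norm _ _).trans (mul_le_mul ?_ ?_ (norm_nonneg _) (by linarith))
      · exact (norm_sub_le _ _).trans (add_le_add (hR _ hu) (hR _ (hmem ω t ht i)))
      · rw [norm_smul, Real.norm_of_nonneg hE.le]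
        exact mul_le_mul_of_nonneg_left (hS_bound t ht j ω) hE.le
    have hround : ∀ t ∈ Finset.range T, ∀ j,
        α * f t j u - ∫ ω, f t j (run ω (t / K) i).x ∂μ
          ≤ ∫ ω, (⟪u - (run ω (t / K) i).x,
              α • sg t j (z t j ω • (run ω (t / K) j).x) (ξ t j ω)⟫
            + C * ‖(run ω (t / K) i).x - (run ω (t / K) j).x‖) ∂μ := by
      intro t ht j
      rw [Finset.mem_range] at ht
      have h1 := integral_regret_le (ℱ.le t) hI h𝒦X h𝒦 h0 hR hL (hf_smooth t ht j)
        (hf_mono t ht j) (hf_dr t ht j) (hf_zero t ht j) (hz' t ht j) (hz_mem t ht j)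
        (hz_law t ht j) (hz_indep t ht j) (hmeas t ht i) (hmeas t ht j)
        (fun ω => hmem ω t ht i) (fun ω => hmem ω t ht j) (hS_int t ht j)
        (hsg_unbiased t ht j) hu
      have hc_int : Integrable (fun ω => α * f t j u - f t j (run ω (t / K) i).x) μ :=
        (integrable_const _).sub (hf_int t ht j)
      have h2 : ∫ ω, (α * f t j u - f t j (run ω (t / K) i).x
            - C * ‖(run ω (t / K) i).x - (run ω (t / K) j).x‖) ∂μ
          = α * f t j u - ∫ ω, f t j (run ω (t / K) i).x ∂μ
            - C * ∫ ω, ‖(run ω (t / K) i).x - (run ω (t / K) j).x‖ ∂μ := by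
        rw [integral_sub hc_int ((hd_int t ht j).const_mul _),
          integral_sub (integrable_const _) (hf_int t ht j), integral_const, probReal_univ,
          one_smul, integral_const_mul]
      rw [integral_add (hin_int t ht j) ((hd_int t ht j).const_mul _), integral_const_mul]
      have h3 := h2.ge.trans h1
      linarith
    have hsum_int : ∀ t ∈ Finset.range T, ∀ j ∈ (Finset.univ : Finset (Fin N)),
        Integrable (fun ω => ⟪u - (run ω (t / K) i).x,
              α • sg t j (z t j ω • (run ω (t / K) j).x) (ξ t j ω)⟫
            + C * ‖(run ω (t / K) i).x - (run ω (t / K) j).x‖) μ := fun t ht j _ =>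
      (hin_int t (Finset.mem_range.1 ht) j).add ((hd_int t (Finset.mem_range.1 ht) j).const_mul C)
    refine (Finset.sum_le_sum fun t ht => Finset.sum_le_sum fun j _ => hround t ht j).trans ?_
    rw [Finset.sum_congr rfl fun t ht => (integral_finsetSum _ (hsum_int t ht)).symm,
      ← integral_finsetSum _ fun t ht => integrable_finsetSum _ (hsum_int t ht)]
    refine (integral_mono (integrable_finsetSum _ fun t ht =>
      integrable_finsetSum _ (hsum_int t ht)) (integrable_const _) fun ω => ?_).trans
      (le_of_eq (by rw [integral_const, probReal_univ, one_smul]))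
    have h1 := sum_inner_boostedGrad_le (z := fun t i => z t i ω) (ξ := fun t i => ξ t i ω)
      hT hK hA h𝒦 h0 hR hG hlo hη hε (fun t ht j => hz_mem t ht j ω) hsg_bound hβ1 hu i
    have h2 := sum_norm_sub_run_le (z := fun t i => z t i ω) (ξ := fun t i => ξ t i ω)
      hT hK hA h𝒦 h0 hR hG hlo hη hε (fun t ht j => hz_mem t ht j ω) hsg_bound hβ1 i
    rw [← hrun, ← hβ] at h1 h2
    simp only [Finset.sum_add_distrib, ← Finset.mul_sum]
    exact add_le_add h1 (mul_le_mul_of_nonneg_left h2 hC0)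
  have hP_int : Integrable (fun ω => 1 / (N : ℝ) *
      ∑ t ∈ Finset.range T, ∑ j, f t j (run ω (t / K) i).x) μ :=
    (integrable_finsetSum _ fun t ht => integrable_finsetSum _ fun j _ =>
      hf_int t (Finset.mem_range.1 ht) j).const_mul _
  have hP_eq : ∫ ω, 1 / (N : ℝ) * ∑ t ∈ Finset.range T, ∑ j, f t j (run ω (t / K) i).x ∂μ
      = 1 / (N : ℝ) * ∑ t ∈ Finset.range T, ∑ j, ∫ ω, f t j (run ω (t / K) i).x ∂μ := by
    rw [integral_const_mul, integral_finsetSum _ fun t ht => integrable_finsetSum _ fun j _ =>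
      hf_int t (Finset.mem_range.1 ht) j]
    congr 1
    exact Finset.sum_congr rfl fun t ht => integral_finsetSum _ fun j _ =>
      hf_int t (Finset.mem_range.1 ht) j
  refine ⟨fun ω t ht => hmem ω t ht i, (integrable_const _).sub hP_int, ?_, fun ω => ?_,
    fun ω m hm => ?_, fun ω => ?_⟩
  · unfold avgRegret
    rw [integral_sub (integrable_const _) hP_int, integral_const, probReal_univ, one_smul, hP_eq]
    set P := 1 / (N : ℝ) * ∑ t ∈ Finset.range T, ∑ j, ∫ ω, f t j (run ω (t / K) i).x ∂μ with hP
    set B := (115 + (Real.sqrt N + 1) * D) * α * R * G * τ₃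
      + C * ((70 + (Real.sqrt N + 1) * D) * R * τ₃) with hB
    have hsup : sSup ((fun u => 1 / (N : ℝ) * ∑ t ∈ Finset.range T, ∑ j, f t j u) '' 𝒦)
        ≤ (B + P) / α := by
      refine csSup_le (Set.Nonempty.image _ ⟨0, h0⟩) ?_
      rintro _ ⟨u, hu, rfl⟩
      rw [le_div_iff₀ hE]
      have h1 := hfixed u hu
      simp only [Finset.sum_sub_distrib, ← Finset.mul_sum] at h1
      have h2 := mul_le_mul_of_nonneg_left h1 (by positivity : 0 ≤ 1 / (N : ℝ))
      have h3 : 1 / (N : ℝ) * (N * ((115 + (Real.sqrt N + 1) * D) * α * R * G * τ₃)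
          + C * (N * ((70 + (Real.sqrt N + 1) * D) * R * τ₃))) = B := by
        rw [hB]; field_simp
      rw [h3, mul_sub] at h2
      simp only
      linarith
    have hmain := mul_le_mul_of_nonneg_left hsup hE.le
    rw [mul_div_cancel₀ _ hE.ne'] at hmain
    have hβ' : 0 < 1 - β := by rw [hβ]; linarith
    have hs0 := Real.sqrt_nonneg (N : ℝ)
    have hs1 : 0 ≤ (Real.sqrt N + 1) * D := by positivity
    have hc1 : 115 + (Real.sqrt N + 1) * D
        ≤ (958 + 86 * (Real.sqrt N + 1)) + 1 / (1 - β) * (842 + 130 * (Real.sqrt N + 1)) := by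
      have e : (Real.sqrt N + 1) * D = 1 / (1 - β) * (130 * (Real.sqrt N + 1)) := by
        rw [hD]; ring
      rw [e, mul_add]
      have : 0 ≤ 1 / (1 - β) * 842 := by positivity
      linarith
    have hc2 : 2 * (70 + (Real.sqrt N + 1) * D)
        ≤ (171 + 260 / (1 - β)) * (Real.sqrt N + 1) := by
      have e : (171 + 260 / (1 - β)) * (Real.sqrt N + 1)
          = 171 * (Real.sqrt N + 1) + 2 * ((Real.sqrt N + 1) * D) := by
        rw [hD]; ring
      rw [e]
      linarith
    have hb1 := mul_le_mul_of_nonneg_right hc1 (by positivity : 0 ≤ α * R * G * τ₃)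
    have hb2 := mul_le_mul_of_nonneg_right hc2
      (by positivity : 0 ≤ Real.exp (-1) * R ^ 2 * L * τ₃)
    have hBeq : B = (115 + (Real.sqrt N + 1) * D) * (α * R * G * τ₃)
        + 2 * (70 + (Real.sqrt N + 1) * D) * (Real.exp (-1) * R ^ 2 * L * τ₃) := by
      rw [hB, hC]; ring
    linarith
  · rw [hdivK]
    refine ((hInv ω K le_rfl).loSteps i).trans (le_of_eq ?_)
    rw [hTK]
  · rw [hdivK] at hm
    rw [(hInv ω _ hm).comms i, (hInv ω m hm.le).comms i]
  · rw [hdivK, (hInv ω K le_rfl).comms i, hK]
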